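/- Let $(R,\mathfrak m)$ be a regular (Noetherian) local ring of dimension $2$ with field of fractions $F$. By a valuation of $F$ centered at $R$ we mean a Krull valuation $\nu$ of $F$ (with values in an arbitrary totally ordered abelian group, $\nu^{-1}(\infty)=\{0\}$) that is non-negative on $R$ and strictly positive on $\mathfrak m$; equivalent valuations are identified. We write $R_\nu=\{f\in F\mid \nu(f)\ge 0\}$ for its valuation ring. A local ring $B\subset F$ dominates a local ring $A\subset F$ if $A\subset B$ and $\mathfrak m_A=A\cap\mathfrak m_B$. For a local domain $(A,\mathfrak m_A)$ contained in $F$, a local point blowing up of $A$ is a local ring $\mathcal O_{X,\xi}\subset F$, where $X\to\operatorname{Spec}A$ is the blowing up along $\mathfrak m_A$ and $\xi\in X$ is a (not necessarily closed) point lying over $\mathfrak m_A$; explicitly, $\mathcal O_{X,\xi}=A[\mathfrak m_A/x]_{\mathfrak q}$ with $0\ne x\in\mathfrak m_A$ and $\mathfrak q$ a prime ideal of $A[\mathfrak m_A/x]$ such that $\mathfrak q\cap A=\mathfrak m_A$. Let $\Pi(R)$ be the set of simple sequences of local point blowings up of $\operatorname{Spec}R$, that is, of finite or infinite sequences $R=R_0,R_1,R_2,\dots$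 of local subrings of $F$ such that each $R_{i+1}$ is a local point blowing up of $R_i$, and the sequence terminates at $R_i$ if and only if the maximal ideal of $R_i$ is principal. Then there is a bijection $\Phi$ from the set of (equivalence classes of) valuations of $F$ centered at $R$ onto $\Pi(R)$ such that: 1. for every valuation $\nu$ of $F$ centered at $R$ and every $\pi^*=(R_i)\in\Pi(R)$, one has $\Phi(\nu)=\pi^*$ if and only if $R_\nu$ dominates every $R_i$; 2. $\Phi(\nu)$ is the sequence of centers of $\nu$: if $R_i,R_{i+1}$ are consecutive terms of $\Phi(\nu)$, then $R_{i+1}$ is the unique local point blowing up of $R_i$ that is dominated by $R_\nu$; 3. if $\Phi(\nu)=(R_i)$, then $R_\nu=\bigcup_i R_i$. In particular every $\pi^*=(R_i)\in\Pi(R)$ determines, up to equivalence, a unique valuation whose ring dominates all the $R_i$, and the union $\bigcup_iR_i$ is the ring of this valuation. -/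

import Mathlib

open IsLocalRing

universe u v

noncomputable section

namespace LocalBlowup

variable {F : Type u} [Field F]

/-- The affine chart `A[𝔪/x]` of the blowing up of `Spec A` along its closed point `𝔪`, for a local
domain `A` contained in the field `F`: the subring of `F` generated by `A` and by all quotients
`a / x` with `a ∈ 𝔪`. The spectra of these rings, for nonzero `x ∈ 𝔪`, form an open cover of the
blowing up. -/
def chart (A : LocalSubring F) (x : F) : Subring F :=
  Subring.closure ((A.toSubring : Set F) ∪
    {y : F | ∃ a ∈ maximalIdeal A.toSubring, y = (a : F) / x})

theorem le_chart (A : LocalSubring F) (x : F) : A.toSubring ≤ chart A x := fun _ ha =>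
  Subring.subset_closure (Or.inl ha)

/-- `B` is the local ring `𝒪_{X,ξ}`, viewed inside `F`, of a point `ξ` of the blowing up
`X → Spec A` along the maximal ideal `𝔪` of `A`, where `ξ` lies over the closed point `𝔪`.
The point is a prime ideal `q` of some chart with `q ∩ A = 𝔪`, and `B` is the localization of the
chart at `q`. -/
def IsLocalBlowup (A B : LocalSubring F) : Prop :=
  ∃ x ∈ maximalIdeal A.toSubring, x ≠ 0 ∧
    ∃ (q : Ideal (chart A (x : F))) (_ : q.IsPrime),
      q.comap (Subring.inclusion (le_chart A (x : F))) = maximalIdeal A.toSubring ∧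
      B = LocalSubring.ofPrime (chart A (x : F)) q

/-- A finite or infinite sequence `R = R₀, R₁, R₂, …` of local subrings of `F` is a simple sequence
of local point blowings up of `Spec R` if every `Rᵢ₊₁` is the local ring of a point, over the closed
point, of the blowing up of `Spec Rᵢ` along its maximal ideal, and the sequence stops at `Rᵢ`
exactly when the maximal ideal of `Rᵢ` is principal. -/
def IsSimpleSequence (R : Type v) [CommRing R] [IsLocalRing R] [Algebra R F]
    (s : Stream'.Seq (LocalSubring F)) : Prop :=
  s.get? 0 = some (LocalSubring.range (algebraMap R F)) ∧
  ∀ (i : ℕ) (A : LocalSubring F), s.get? i = some A →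
    ((maximalIdeal A.toSubring).IsPrincipal → s.get? (i + 1) = none) ∧
    (¬ (maximalIdeal A.toSubring).IsPrincipal →
      ∃ B, s.get? (i + 1) = some B ∧ IsLocalBlowup A B)

/-- The set `Π(R)` of simple sequences (finite or infinite) of local point blowings up of
`Spec R`. -/
def SimpleSequence (R : Type v) (F : Type u) [Field F] [CommRing R] [IsLocalRing R]
    [Algebra R F] : Type u :=
  {s : Stream'.Seq (LocalSubring F) // IsSimpleSequence R s}

/-- The union `R̄` of the rings of a sequence. -/
def SimpleSequence.union {R : Type v} [CommRing R] [IsLocalRing R] [Algebra R F]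
    (s : SimpleSequence R F) : Set F :=
  ⋃ A ∈ s.1, (A.toSubring : Set F)

/-- A Krull valuation of `F` (written multiplicatively) that is centered at the local ring `R`:
non-negative on `R` and strictly positive on the maximal ideal, in additive terms. Every Krull
valuation of `F` is equivalent to one with values in the universe of `F`. -/
structure CenteredValuation (R : Type v) (F : Type u) [Field F] [CommRing R] [IsLocalRing R]
    [Algebra R F] : Type (u + 1) where
  Γ₀ : Type u
  [instΓ₀ : LinearOrderedCommGroupWithZero Γ₀]
  val : Valuation F Γ₀
  val_le_one : ∀ r : R, val (algebraMap R F r) ≤ 1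
  val_lt_one : ∀ r ∈ maximalIdeal R, val (algebraMap R F r) < 1

attribute [instance] CenteredValuation.instΓ₀

/-- The valuation ring `R_ν` of `ν`, as a local subring of `F`. The order on local subrings is
domination. -/
def CenteredValuation.ring {R : Type v} [CommRing R] [IsLocalRing R] [Algebra R F]
    (ν : CenteredValuation R F) : LocalSubring F :=
  ν.val.valuationSubring.toLocalSubring

/-- Equivalence of Krull valuations. -/
instance CenteredValuation.setoid (R : Type v) (F : Type u) [Field F] [CommRing R]
    [IsLocalRing R] [Algebra R F] : Setoid (CenteredValuation R F) where
  r ν μ := ν.val.IsEquiv μ.val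
  iseqv := ⟨fun _ => Valuation.IsEquiv.refl, fun h => h.symm, fun h k => h.trans k⟩

end LocalBlowup

end

/-! A valuation ring dominating `A` dominates exactly one local point blowing up of `A` when `𝔪` is
not principal. Uniqueness (`IsLocalBlowup.eq_of_le`) is separatedness of the blowing up, and
existence (`exists_isLocalBlowup_le`) is properness: one of `y / x`, `x / y` lies in the valuation
ring. Iterating gives the sequence of centres. The process can continue because a local blowing up
of a two-dimensional regular ring is again regular of dimension two or has principal maximal ideal:
the exceptional fibre of a chart is a polynomial ring over the residue field
(`IsRegularPair.quotientEquiv`).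

Conversely, the union of a simple sequence must be shown to be a valuation ring. Valuation rings are
maximal for domination, so the union is then the only valuation ring dominating all members, which
yields injectivity, surjectivity and the description of `R_ν` at once. A finite sequence ends in a
Noetherian local domain with principal maximal ideal, which is a valuation ring.

The infinite case is `exists_mem_or_inv_mem`. Suppose neither `f` nor `f⁻¹` lies in any `A i`, and
write `f = a / b` with `a`, `b` coprime in `A 0`. Each step divides both `a` and `b` by a parameter
`x j`. Since every `A i` is normal, `f` is residually transcendental over it, so `A i [f]` localized
at the extension of the maximal ideal is a local ring dominating `A i`. For `i = 0` this ring `B` is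
Noetherian of dimension at most one, and `b` has finite order in it. But in the ring for `i = n`,
which contains `B`, `b` is divisible by a product of `n` nonunits, which forces the order of `b` in
`B` to be at least `n`, for every `n`. -/

noncomputable section

namespace LocalBlowup

/-! ### Algebra of two-dimensional regular local rings. -/

section RegularPair

/-- A pair of generators `x`, `y` of the maximal ideal such that `x` is prime and does not divide
`y`. A Noetherian local domain has such a pair iff it is regular of dimension two. -/
structure IsRegularPair {A : Type*} [CommRing A] [IsLocalRing A] (x y : A) : Prop where
  span_eq : maximalIdeal A = Ideal.span {x, y}
  prime : Prime x
  not_dvd : ¬ x ∣ y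

variable {A : Type*} [CommRing A] [IsLocalRing A] {x y : A}

namespace IsRegularPair

theorem left_mem (h : IsRegularPair x y) : x ∈ maximalIdeal A :=
  h.span_eq ▸ Ideal.subset_span (by simp)

theorem right_mem (h : IsRegularPair x y) : y ∈ maximalIdeal A :=
  h.span_eq ▸ Ideal.subset_span (by simp)

theorem isPrime_span (h : IsRegularPair x y) : (Ideal.span {x}).IsPrime :=
  (Ideal.span_singleton_prime h.prime.ne_zero).2 h.prime

/-- `A / (x)` is a Noetherian local domain whose maximal ideal is generated by the image of `y`. -/
theorem isPrincipalIdealRing_quotient [IsNoetherianRing A] (h : IsRegularPair x y) :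
    IsPrincipalIdealRing (A ⧸ Ideal.span {x}) := by
  have := h.isPrime_span
  have : IsLocalRing (A ⧸ Ideal.span {x}) :=
    .of_surjective' (Ideal.Quotient.mk _) Ideal.Quotient.mk_surjective
  refine ((tfae_of_isNoetherianRing_of_isLocalRing_of_isDomain (A ⧸ Ideal.span {x})).out 4 0).1 ?_
  refine ⟨Ideal.Quotient.mk _ y, ?_⟩
  have hs : Function.Surjective (Ideal.Quotient.mk (Ideal.span {x})) :=
    Ideal.Quotient.mk_surjective
  have : (maximalIdeal A).map (Ideal.Quotient.mk (Ideal.span {x})) =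
      maximalIdeal (A ⧸ Ideal.span {x}) :=
    eq_maximalIdeal <| (Ideal.map_eq_top_or_isMaximal_of_surjective _ hs
      (maximalIdeal.isMaximal A)).resolve_left fun ht => by
      have : IsLocalHom (Ideal.Quotient.mk (Ideal.span {x})) := .of_surjective _ hs
      have := ((local_hom_TFAE (Ideal.Quotient.mk (Ideal.span {x}))).out 0 2).1 this
      exact (maximalIdeal.isMaximal _).ne_top (top_le_iff.1 (ht ▸ this))
  rw [← this, h.span_eq, Ideal.map_span, Set.image_pair,
    Ideal.Quotient.eq_zero_iff_mem.2 (Ideal.mem_span_singleton_self x)]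
  simp [Ideal.submodule_span_eq]

/-- Lift a generator of the image of `p` in `A / (x)` to `g ∈ p`. Since `x ∉ p`, an element of `p`
divisible by `x` lies in `x p`; hence `p = (g) + x p`, and Nakayama applies. -/
theorem isPrincipal_of_notMem [IsNoetherianRing A] (h : IsRegularPair x y) (p : Ideal A)
    [p.IsPrime] (hx : x ∉ p) : p.IsPrincipal := by
  have := h.isPrincipalIdealRing_quotient
  obtain ⟨g', hg'⟩ := IsPrincipalIdealRing.principal (p.map (Ideal.Quotient.mk (Ideal.span {x})))
  have hg'm : g' ∈ p.map (Ideal.Quotient.mk (Ideal.span {x})) :=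
    hg' ▸ Ideal.mem_span_singleton_self g'
  obtain ⟨g, hg, rfl⟩ :=
    (Ideal.mem_map_iff_of_surjective _ Ideal.Quotient.mk_surjective).1 hg'm
  refine ⟨g, le_antisymm ?_ ((Ideal.span_singleton_le_iff_mem _).2 hg)⟩
  refine Submodule.le_of_le_smul_of_le_jacobson_bot (I := Ideal.span {x})
    (IsNoetherian.noetherian p) ?_ ?_
  · rw [jacobson_eq_maximalIdeal _ bot_ne_top, Ideal.span_singleton_le_iff_mem]
    exact h.left_mem
  · intro u hu
    have hu' := Ideal.mem_map_of_mem (Ideal.Quotient.mk (Ideal.span {x})) hu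
    rw [hg', Ideal.submodule_span_eq, Ideal.mem_span_singleton'] at hu'
    obtain ⟨c', hc⟩ := hu'
    obtain ⟨c, rfl⟩ := Ideal.Quotient.mk_surjective c'
    rw [← map_mul, eq_comm, Ideal.Quotient.eq, Ideal.mem_span_singleton'] at hc
    obtain ⟨w, hw⟩ := hc
    have hwp : w ∈ p := by
      have : w * x ∈ p := hw ▸ p.sub_mem hu (p.mul_mem_left c hg)
      exact ((Ideal.IsPrime.mem_or_mem ‹_› this).resolve_right hx)
    have : u = c * g + x • w := by rw [smul_eq_mul, mul_comm x, hw]; ring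
    rw [this]
    exact Submodule.add_mem_sup (Ideal.mem_span_singleton'.2 ⟨c, rfl⟩)
      (Submodule.smul_mem_smul (Ideal.mem_span_singleton_self x) hwp)

/-- Kaplansky's criterion: every nonzero prime contains a prime element, namely `x` or a generator.
-/
theorem uniqueFactorizationMonoid [IsDomain A] [IsNoetherianRing A] (h : IsRegularPair x y) :
    UniqueFactorizationMonoid A := by
  refine UniqueFactorizationMonoid.iff_exists_prime_mem_of_isPrime.2 fun p hp _ => ?_
  by_cases hx : x ∈ p
  · exact ⟨x, hx, h.prime⟩
  · have := h.isPrincipal_of_notMem p hx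
    exact ⟨_, Submodule.IsPrincipal.generator_mem p,
      Submodule.IsPrincipal.prime_generator_of_isPrime p hp⟩

theorem eq_maximalIdeal_or_isPrincipal [IsNoetherianRing A] (h : IsRegularPair x y) (p : Ideal A)
    [p.IsPrime] : p = maximalIdeal A ∨ p.IsPrincipal := by
  by_cases hx : x ∈ p
  swap
  · exact .inr (h.isPrincipal_of_notMem p hx)
  have hxp : Ideal.span {x} ≤ p := (Ideal.span_singleton_le_iff_mem _).2 hx
  by_cases hp : p = Ideal.span {x}
  · exact .inr ⟨x, hp⟩
  left
  have := h.isPrincipalIdealRing_quotient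
  have := h.isPrime_span
  have hc : (p.map (Ideal.Quotient.mk (Ideal.span {x}))).comap (Ideal.Quotient.mk _) = p := by
    rw [Ideal.comap_map_of_surjective _ Ideal.Quotient.mk_surjective,
      ← RingHom.ker_eq_comap_bot, Ideal.mk_ker, sup_eq_left.2 hxp]
  have hp' : (p.map (Ideal.Quotient.mk (Ideal.span {x}))).IsPrime :=
    Ideal.map_isPrime_of_surjective Ideal.Quotient.mk_surjective (by rwa [Ideal.mk_ker])
  have hb : p.map (Ideal.Quotient.mk (Ideal.span {x})) ≠ ⊥ := fun hb => hp <| by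
    rw [← hc, hb, ← RingHom.ker_eq_comap_bot, Ideal.mk_ker]
  have := IsPrime.to_maximal_ideal hb
  rw [← hc]
  exact eq_maximalIdeal (Ideal.comap_isMaximal_of_surjective _ Ideal.Quotient.mk_surjective)

theorem symm [IsDomain A] [IsNoetherianRing A] (h : IsRegularPair x y) : IsRegularPair y x := by
  have := h.uniqueFactorizationMonoid
  have hyx : ¬ y ∣ x := by
    rintro ⟨c, hc⟩
    obtain ⟨d, hd⟩ :=
      (h.prime.dvd_or_dvd (Dvd.intro_left 1 (by rw [one_mul, hc]))).resolve_left h.not_dvd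
    have : x * (y * d) = x * 1 := by rw [mul_one]; nth_rw 2 [hc]; rw [hd]; ring
    exact h.right_mem (IsUnit.of_mul_eq_one _ (mul_left_cancel₀ h.prime.ne_zero this))
  refine ⟨by rw [h.span_eq, Set.pair_comm], ?_, hyx⟩
  rw [← UniqueFactorizationMonoid.irreducible_iff_prime]
  refine ⟨h.right_mem, fun u v huv => ?_⟩
  by_contra! H
  have hu : u ∈ Ideal.span {x, y} := h.span_eq ▸ H.1
  have hv : v ∈ Ideal.span {x, y} := h.span_eq ▸ H.2
  obtain ⟨a, b, rfl⟩ := Ideal.mem_span_pair.1 hu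
  obtain ⟨c, d, rfl⟩ := Ideal.mem_span_pair.1 hv
  -- Expanding `y = u v` modulo `x` gives `y ≡ b d y²`; the second factor is a unit, so `x` would
  -- divide `y`.
  have : x ∣ y * (1 - b * d * y) :=
    ⟨a * (c * x + d * y) + b * y * c, by linear_combination huv⟩
  obtain h1 | h1 := h.prime.dvd_or_dvd this
  · exact h.not_dvd h1
  · have h2 : 1 - b * d * y ∈ maximalIdeal A := Ideal.mem_of_dvd _ h1 h.left_mem
    exact (maximalIdeal.isMaximal A).ne_top <| (Ideal.eq_top_iff_one _).2 <| by
      simpa only [sub_add_cancel] using add_mem h2 (Ideal.mul_mem_left _ (b * d) h.right_mem)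

theorem exists_of_mem_pow (h : IsRegularPair x y) (n : ℕ) {z : A}
    (hz : z ∈ maximalIdeal A ^ (n + 1)) :
    ∃ w ∈ maximalIdeal A ^ n, ∃ c, z = x * w + c * y ^ (n + 1) := by
  induction n generalizing z with
  | zero =>
    rw [zero_add, pow_one, h.span_eq] at hz
    obtain ⟨a, b, rfl⟩ := Ideal.mem_span_pair.1 hz
    exact ⟨a, by simp, b, by ring⟩
  | succ n ih =>
    rw [pow_succ] at hz
    refine Submodule.mul_induction_on hz (fun u hu v hv => ?_) ?_
    · obtain ⟨w, hw, c, rfl⟩ := ih hu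
      have hv' := hv
      rw [h.span_eq] at hv'
      obtain ⟨a, b, rfl⟩ := Ideal.mem_span_pair.1 hv'
      refine ⟨w * (a * x + b * y) + c * y ^ (n + 1) * a, add_mem ?_ ?_, c * b, by ring⟩
      · rw [pow_succ]
        exact Ideal.mul_mem_mul hw hv
      · exact Ideal.mul_mem_right _ _ (Ideal.mul_mem_left _ _ (Ideal.pow_mem_pow h.right_mem _))
    · rintro _ _ ⟨w, hw, c, rfl⟩ ⟨w', hw', c', rfl⟩
      exact ⟨w + w', add_mem hw hw', c + c', by ring⟩

/-- The initial form of `x` is a nonzerodivisor in the associated graded ring. -/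
theorem mem_pow_of_mul_mem_pow [IsDomain A] (h : IsRegularPair x y) (n : ℕ) {z : A}
    (hz : x * z ∈ maximalIdeal A ^ (n + 1)) : z ∈ maximalIdeal A ^ n := by
  obtain ⟨w, hw, c, hc⟩ := h.exists_of_mem_pow n hz
  have : x ∣ c * y ^ (n + 1) := ⟨z - w, by linear_combination -hc⟩
  obtain ⟨d, rfl⟩ := (h.prime.dvd_or_dvd this).resolve_right
    fun H => h.not_dvd (h.prime.dvd_of_dvd_pow H)
  have : z = w + d * y * y ^ n := mul_left_cancel₀ h.prime.ne_zero (by rw [hc]; ring)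
  rw [this]
  exact add_mem hw (Ideal.mul_mem_left _ _ (Ideal.pow_mem_pow h.right_mem _))

/-- Analytic independence of `x`, `y`. Working modulo `x` isolates the coefficient of the pure power
of `y`; the remaining terms are divisible by `x`, and cancelling it lowers the degree. -/
theorem coeff_mem_of_form_mem_pow [IsDomain A] (h : IsRegularPair x y) (n : ℕ) (c : ℕ → A)
    (hc : ∑ i ∈ Finset.range (n + 1), c i * x ^ (n - i) * y ^ i ∈ maximalIdeal A ^ (n + 1)) :
    ∀ i ≤ n, c i ∈ maximalIdeal A := by
  induction n with
  | zero =>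
    intro i hi
    obtain rfl := Nat.le_zero.1 hi
    simpa using hc
  | succ n ih =>
    have key : ∑ i ∈ Finset.range (n + 1 + 1), c i * x ^ (n + 1 - i) * y ^ i =
        x * ∑ i ∈ Finset.range (n + 1), c i * x ^ (n - i) * y ^ i + c (n + 1) * y ^ (n + 1) := by
      rw [Finset.sum_range_succ, Finset.mul_sum]
      congr 1
      · refine Finset.sum_congr rfl fun i hi => ?_
        have : n + 1 - i = n - i + 1 := by have := Finset.mem_range.1 hi; omega
        rw [this]
        ring
      · simp
    rw [key] at hc
    have hl : c (n + 1) ∈ maximalIdeal A := by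
      obtain ⟨w, -, d, hd⟩ := h.exists_of_mem_pow _ hc
      have : x ∣ y ^ (n + 1) * (c (n + 1) - d * y) :=
        ⟨w - ∑ i ∈ Finset.range (n + 1), c i * x ^ (n - i) * y ^ i, by linear_combination hd⟩
      have := (h.prime.dvd_or_dvd this).resolve_left
        fun H => h.not_dvd (h.prime.dvd_of_dvd_pow H)
      have := add_mem (Ideal.mem_of_dvd _ this h.left_mem) (Ideal.mul_mem_left _ d h.right_mem)
      simpa using this
    have hr : c (n + 1) * y ^ (n + 1) ∈ maximalIdeal A ^ (n + 1 + 1) := by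
      rw [pow_succ' _ (n + 1)]
      exact Ideal.mul_mem_mul hl (Ideal.pow_mem_pow h.right_mem _)
    have := h.mem_pow_of_mul_mem_pow _ ((Ideal.add_mem_iff_left _ hr).1 hc)
    intro i hi
    obtain rfl | hi := Nat.le_succ_iff.1 hi |>.symm
    · exact hl
    · exact ih this i hi

end IsRegularPair

end RegularPair

/-! ### The charts of the blowing up and their exceptional fibres. -/

section Chart

open Polynomial

/-- A regular local domain of dimension two has a regular pair of parameters. -/
theorem exists_isRegularPair {R : Type*} [CommRing R] [IsDomain R] [IsRegularLocalRing R]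
    (hdim : ringKrullDim R = 2) : ∃ x y : R, IsRegularPair x y := by
  have hr : (maximalIdeal R).spanFinrank = 2 := by
    have := IsRegularLocalRing.spanFinrank_maximalIdeal (R := R)
    rw [hdim] at this
    exact_mod_cast this
  have hfg : (maximalIdeal R).FG := IsNoetherian.noetherian _
  have hht : (maximalIdeal R).height = 2 := by
    have := maximalIdeal_height_eq_ringKrullDim (R := R)
    rw [hdim] at this
    exact WithBot.coe_injective this
  obtain ⟨s, hs, hspan⟩ := Submodule.FG.exists_span_set_encard_eq_spanFinrank hfg
  rw [hr, Nat.cast_ofNat, Set.encard_eq_two] at hs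
  obtain ⟨x, y, hxy, rfl⟩ := hs
  have hspan : Ideal.span {x, y} = maximalIdeal R := hspan
  have hx0 : x ≠ 0 := by
    rintro rfl
    have h1 : maximalIdeal R = Ideal.span {y} := by rw [← hspan, Ideal.span_insert_zero]
    have : (maximalIdeal R).height ≤ 1 := by
      have : (maximalIdeal R).IsPrincipal := ⟨y, h1⟩
      refine Ideal.height_le_one_of_isPrincipal_of_mem_minimalPrimes (maximalIdeal R) _ ?_
      rw [Ideal.minimalPrimes_eq_subsingleton_self]
      rfl
    rw [hht] at this
    norm_num at this
  have hxm : x ∈ maximalIdeal R := hspan ▸ Ideal.subset_span (by simp)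
  obtain ⟨p, hp, hpm⟩ :=
    Ideal.exists_minimalPrimes_le ((Ideal.span_singleton_le_iff_mem _).2 hxm)
  have hpp : p.IsPrime := hp.1.1
  have hpx : Ideal.span {x} ≤ p := hp.1.2
  have hp1 : p.height ≤ 1 := Ideal.height_le_one_of_isPrincipal_of_mem_minimalPrimes _ p hp
  -- A minimal prime over `x` has height at most one by Krull, so it is not the maximal ideal.
  have hyp : y ∉ p := fun hy => by
    have : p = maximalIdeal R := le_antisymm hpm <| hspan ▸ Ideal.span_le.2 (by
      rintro z (rfl | rfl)
      · exact hpx (Ideal.mem_span_singleton_self _)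
      · exact hy)
    rw [this, hht] at hp1
    norm_num at hp1
  -- If `a x + b y ∈ p`, then `b ∈ p` because `y ∉ p`. Hence `p ≤ (x) + 𝔪 p`, and Nakayama gives
  -- that `x` is prime.
  have hpe : p = Ideal.span {x} := by
    refine le_antisymm ?_ hpx
    refine Submodule.le_of_le_smul_of_le_jacobson_bot (I := maximalIdeal R)
      (IsNoetherian.noetherian p) (jacobson_eq_maximalIdeal _ bot_ne_top).ge fun u hu => ?_
    obtain ⟨a, b, rfl⟩ := Ideal.mem_span_pair.1 (hspan ▸ hpm hu)
    have hax : a * x ∈ Ideal.span {x} := Ideal.mem_span_singleton'.2 ⟨a, rfl⟩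
    have hb : b ∈ p :=
      (hpp.mem_or_mem ((Ideal.add_mem_iff_right _ (hpx hax)).1 hu)).resolve_right hyp
    refine Submodule.add_mem_sup hax ?_
    rw [mul_comm]
    exact Ideal.mul_mem_mul (hspan ▸ Ideal.subset_span (by simp)) hb
  exact ⟨x, y, hspan.symm, (Ideal.span_singleton_prime hx0).1 (hpe ▸ hpp),
    fun h => hyp (hpe ▸ Ideal.mem_span_singleton.2 h)⟩

variable {A T : Type*} [CommRing A] [CommRing T] [Algebra A T] {x y : A}

/-- Clearing denominators in `P(y / x)` turns divisibility questions in the chart into questions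
about forms over `A`. -/
theorem pow_mul_aeval_eq_form {t : T} (ht : algebraMap A T x * t = algebraMap A T y) {n : ℕ}
    (P : A[X]) (hn : P.natDegree ≤ n) :
    algebraMap A T x ^ n * aeval t P =
      algebraMap A T (∑ i ∈ Finset.range (n + 1), P.coeff i * x ^ (n - i) * y ^ i) := by
  rw [aeval_eq_sum_range' (Nat.lt_succ_of_le hn), Finset.mul_sum, map_sum]
  refine Finset.sum_congr rfl fun i hi => ?_
  have hi : i ≤ n := Nat.lt_succ_iff.1 (Finset.mem_range.1 hi)
  rw [map_mul, map_mul, map_pow, map_pow, ← ht, mul_pow, Algebra.smul_def,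
    ← Nat.sub_add_cancel hi, pow_add, Nat.sub_add_cancel hi]
  ring

variable [IsLocalRing A]

theorem IsRegularPair.form_mem_pow (h : IsRegularPair x y) (n : ℕ) (c : ℕ → A) :
    ∑ i ∈ Finset.range (n + 1), c i * x ^ (n - i) * y ^ i ∈ maximalIdeal A ^ n := by
  refine Ideal.sum_mem _ fun i hi => ?_
  have hi : i ≤ n := Nat.lt_succ_iff.1 (Finset.mem_range.1 hi)
  rw [mul_assoc]
  refine Ideal.mul_mem_left _ _ ?_
  have := Ideal.mul_mem_mul (Ideal.pow_mem_pow h.left_mem (n - i))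
    (Ideal.pow_mem_pow h.right_mem i)
  rwa [← pow_add, Nat.sub_add_cancel hi] at this

/-- If `t = y / x`, then `x` divides `P(t)` in `A[t]` iff all coefficients of `P` are in the maximal
ideal. -/
theorem IsRegularPair.dvd_aeval_iff [IsDomain A] [FaithfulSMul A T] (h : IsRegularPair x y) {t : T}
    (ht : algebraMap A T x * t = algebraMap A T y)
    (hs : Function.Surjective (aeval (R := A) t)) (P : A[X]) :
    algebraMap A T x ∣ aeval t P ↔ ∀ i, P.coeff i ∈ maximalIdeal A := by
  have hinj : Function.Injective (algebraMap A T) := FaithfulSMul.algebraMap_injective A T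
  constructor
  · rintro ⟨z, hz⟩ i
    obtain ⟨Q, rfl⟩ := hs z
    -- Both polynomials are homogenized in the same degree, large enough to include the index `i`.
    set n := max (max P.natDegree Q.natDegree) i
    have hP := pow_mul_aeval_eq_form ht P (n := n) (by simp [n])
    have hQ := pow_mul_aeval_eq_form ht Q (n := n) (by simp [n])
    have hPQ : ∑ i ∈ Finset.range (n + 1), P.coeff i * x ^ (n - i) * y ^ i =
        x * ∑ i ∈ Finset.range (n + 1), Q.coeff i * x ^ (n - i) * y ^ i :=
      hinj (by rw [map_mul, ← hP, ← hQ, hz]; ring)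
    refine h.coeff_mem_of_form_mem_pow n P.coeff ?_ i (by simp [n])
    rw [hPQ, pow_succ']
    exact Ideal.mul_mem_mul h.left_mem (h.form_mem_pow n _)
  · intro hP
    rw [aeval_eq_sum_range]
    refine Finset.dvd_sum fun i _ => ?_
    have := hP i
    rw [h.span_eq] at this
    obtain ⟨a, b, hab⟩ := Ideal.mem_span_pair.1 this
    rw [Algebra.smul_def]
    refine Dvd.dvd.mul_right ⟨algebraMap A T a + algebraMap A T b * t, ?_⟩ _
    rw [← hab, map_add, map_mul, map_mul, ← ht]
    ring

/-- If `t = y / x`, then the fibre `A[t] / (x)` is a polynomial ring over the residue field. -/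
def IsRegularPair.quotientEquiv [IsDomain A] [FaithfulSMul A T] (h : IsRegularPair x y) {t : T}
    (ht : algebraMap A T x * t = algebraMap A T y)
    (hs : Function.Surjective (aeval (R := A) t)) :
    T ⧸ Ideal.span {algebraMap A T x} ≃+* (ResidueField A)[X] :=
  let f : A[X] →+* T ⧸ Ideal.span {algebraMap A T x} :=
    (Ideal.Quotient.mk _).comp (aeval (R := A) t).toRingHom
  let g : A[X] →+* (ResidueField A)[X] := mapRingHom (residue A)
  have hf : Function.Surjective f := Ideal.Quotient.mk_surjective.comp hs
  have hg : Function.Surjective g := map_surjective _ residue_surjective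
  have hfg : RingHom.ker f = RingHom.ker g := by
    ext P
    rw [RingHom.mem_ker, RingHom.mem_ker]
    simp only [f, g, RingHom.comp_apply, Ideal.Quotient.eq_zero_iff_mem, Ideal.mem_span_singleton]
    refine (h.dvd_aeval_iff ht hs P).trans ?_
    simp [Polynomial.ext_iff]
  (RingHom.quotientKerEquivOfSurjective hf).symm.trans
    ((Ideal.quotEquivOfEq hfg).trans (RingHom.quotientKerEquivOfSurjective hg))

/-- Lifting a generator of `q / (z)` gives `q = (z, g)`. If `z` divides `g` in `B`, then `z` alone
generates; otherwise `z`, which stays prime after localization, and `g` form a regular pair. -/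
theorem isPrincipal_or_isRegularPair_of_isLocalization {T : Type*} [CommRing T] [IsDomain T]
    {z : T} (hz : z ≠ 0)
    [IsDomain (T ⧸ Ideal.span {z})] [IsPrincipalIdealRing (T ⧸ Ideal.span {z})]
    (q : Ideal T) [q.IsPrime] (hq : z ∈ q) (B : Type*) [CommRing B] [IsDomain B] [IsLocalRing B]
    [Algebra T B] [IsLocalization.AtPrime B q] :
    (maximalIdeal B).IsPrincipal ∨ ∃ g : B, IsRegularPair (algebraMap T B z) g := by
  have hzp : (Ideal.span {z}).IsPrime := (Ideal.Quotient.isDomain_iff_prime _).1 ‹_›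
  have hzq : Ideal.span {z} ≤ q := (Ideal.span_singleton_le_iff_mem _).2 hq
  obtain ⟨g', hg'⟩ := IsPrincipalIdealRing.principal (q.map (Ideal.Quotient.mk (Ideal.span {z})))
  obtain ⟨g, rfl⟩ := Ideal.Quotient.mk_surjective g'
  have hqg : q = Ideal.span {z, g} := by
    have hc : (q.map (Ideal.Quotient.mk (Ideal.span {z}))).comap (Ideal.Quotient.mk _) = q := by
      rw [Ideal.comap_map_of_surjective _ Ideal.Quotient.mk_surjective,
        ← RingHom.ker_eq_comap_bot, Ideal.mk_ker, sup_eq_left.2 hzq]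
    rw [← hc, hg', Ideal.submodule_span_eq, ← Set.image_singleton, ← Ideal.map_span,
      Ideal.comap_map_of_surjective _ Ideal.Quotient.mk_surjective,
      ← RingHom.ker_eq_comap_bot, Ideal.mk_ker, Ideal.span_insert, sup_comm]
  have hm : maximalIdeal B = Ideal.span {algebraMap T B z, algebraMap T B g} := by
    rw [← IsLocalization.AtPrime.map_eq_maximalIdeal q B, hqg, Ideal.map_span, Set.image_pair]
  by_cases hd : algebraMap T B z ∣ algebraMap T B g
  · left
    refine ⟨algebraMap T B z, ?_⟩
    rw [hm, Ideal.span_insert, Ideal.submodule_span_eq, sup_eq_left]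
    exact Ideal.span_singleton_le_span_singleton.2 hd
  · right
    refine ⟨algebraMap T B g, hm, ?_, hd⟩
    have hinj : Function.Injective (algebraMap T B) :=
      IsLocalization.injective B q.primeCompl_le_nonZeroDivisors
    rw [← Ideal.span_singleton_prime ((map_ne_zero_iff _ hinj).2 hz), ← Set.image_singleton,
      ← Ideal.map_span]
    refine IsLocalization.isPrime_of_isPrime_disjoint q.primeCompl B _ hzp ?_
    exact Set.disjoint_left.2 fun u hu hu' => hu (hzq hu')

end Chart

/-! ### Domination and local blowings up inside the field. -/

section Subrings

variable {F : Type u} [Field F]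

theorem isUnit_iff_inv_mem {S : Subring F} {z : S} :
    IsUnit z ↔ z ≠ 0 ∧ (z : F)⁻¹ ∈ S := by
  constructor
  · intro h
    obtain ⟨w, hw⟩ := h.exists_right_inv
    have hw' : (z : F) * w = 1 := congrArg Subtype.val hw
    refine ⟨fun h0 => by simp [h0] at hw', ?_⟩
    rw [inv_eq_of_mul_eq_one_right hw']
    exact w.2
  · rintro ⟨h0, h⟩
    refine IsUnit.of_mul_eq_one ⟨_, h⟩ (Subtype.ext ?_)
    exact mul_inv_cancel₀ fun H => h0 (Subtype.ext H)

theorem mem_maximalIdeal_iff_inv {A : LocalSubring F} {z : A.toSubring} :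
    z ∈ maximalIdeal A.toSubring ↔ z = 0 ∨ (z : F)⁻¹ ∉ A.toSubring := by
  rw [mem_maximalIdeal, mem_nonunits_iff, isUnit_iff_inv_mem, not_and_or, not_not]

/-- This reduces domination to membership of inverses in `F`, the form in which all later arguments
use it. -/
theorem le_iff_inv_mem {A C : LocalSubring F} :
    A ≤ C ↔ A.toSubring ≤ C.toSubring ∧
      ∀ z ∈ A.toSubring, z⁻¹ ∈ C.toSubring → z⁻¹ ∈ A.toSubring := by
  constructor
  · rintro ⟨h, hl⟩
    refine ⟨h, fun z hz hz' => ?_⟩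
    by_cases h0 : z = 0
    · simp [h0]
    have : IsUnit (Subring.inclusion h ⟨z, hz⟩) :=
      isUnit_iff_inv_mem.2 ⟨fun H => h0 (congrArg Subtype.val H), hz'⟩
    exact (isUnit_iff_inv_mem.1 (hl.map_nonunit _ this)).2
  · rintro ⟨h, hl⟩
    refine ⟨h, ⟨fun z hz => ?_⟩⟩
    obtain ⟨h0, hz'⟩ := isUnit_iff_inv_mem.1 hz
    exact isUnit_iff_inv_mem.2 ⟨fun H => h0 (by rw [H, map_zero]), hl z z.2 hz'⟩

theorem mem_maximalIdeal_of_le {A C : LocalSubring F} (h : A ≤ C) {z : A.toSubring} :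
    Subring.inclusion h.1 z ∈ maximalIdeal C.toSubring ↔ z ∈ maximalIdeal A.toSubring := by
  have := h.2
  exact map_mem_nonunits_iff (Subring.inclusion h.1) z

theorem mem_ofPrime_iff {T : Subring F} {q : Ideal T} [q.IsPrime] {z : F} :
    z ∈ (LocalSubring.ofPrime T q).toSubring ↔ ∃ a s : T, s ∉ q ∧ z = a / s := by
  constructor
  · intro hz
    obtain ⟨a, s, h⟩ := IsLocalization.exists_mk'_eq q.primeCompl
      (⟨z, hz⟩ : (LocalSubring.ofPrime T q).toSubring)
    refine ⟨a, s, s.2, ?_⟩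
    rw [IsLocalization.mk'_eq_iff_eq_mul] at h
    have h' : (a : F) = z * s := congrArg Subtype.val h
    have hs : (s : F) ≠ 0 := fun H => s.2 (by
      have : (s : T) = 0 := Subtype.ext H
      rw [this]
      exact q.zero_mem)
    rw [h', mul_div_cancel_right₀ _ hs]
  · rintro ⟨a, s, hs, rfl⟩
    have hu := IsLocalization.map_units (LocalSubring.ofPrime T q).toSubring
      (⟨s, hs⟩ : q.primeCompl)
    rw [div_eq_mul_inv]
    exact mul_mem (LocalSubring.le_ofPrime T q a.2) (isUnit_iff_inv_mem.1 hu).2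

theorem inv_mem_ofPrime {T : Subring F} {q : Ideal T} [q.IsPrime] {s : T} (hs : s ∉ q) :
    (s : F)⁻¹ ∈ (LocalSubring.ofPrime T q).toSubring :=
  mem_ofPrime_iff.2 ⟨1, s, hs, by simp⟩

theorem mem_maximalIdeal_ofPrime_iff {T : Subring F} {q : Ideal T} [q.IsPrime] {s : T} :
    Subring.inclusion (LocalSubring.le_ofPrime T q) s ∈
      maximalIdeal (LocalSubring.ofPrime T q).toSubring ↔ s ∈ q :=
  IsLocalization.AtPrime.to_map_mem_maximal_iff _ q s

/-- The localization of a subring of a local ring `C` at the centre of `C` is dominated by `C`. -/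
theorem ofPrime_comap_le {T : Subring F} {C : LocalSubring F} (hT : T ≤ C.toSubring) :
    LocalSubring.ofPrime T ((maximalIdeal C.toSubring).comap (Subring.inclusion hT)) ≤ C := by
  have hC : ∀ s : T, s ∉ (maximalIdeal C.toSubring).comap (Subring.inclusion hT) →
      (s : F)⁻¹ ∈ C.toSubring := fun s hs => by
    rw [Ideal.mem_comap, mem_maximalIdeal_iff_inv, not_or, not_not] at hs
    exact hs.2
  refine le_iff_inv_mem.2 ⟨fun z hz => ?_, fun z hz hz' => ?_⟩
  · obtain ⟨a, s, hs, rfl⟩ := mem_ofPrime_iff.1 hz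
    rw [div_eq_mul_inv]
    exact mul_mem (hT a.2) (hC s hs)
  · obtain ⟨a, s, hs, rfl⟩ := mem_ofPrime_iff.1 hz
    by_cases ha : (a : F) = 0
    · simp [ha]
    have hs0 : (s : F) ≠ 0 := fun H => hs (by
      have : s = 0 := Subtype.ext H
      rw [this]
      exact Ideal.zero_mem _)
    refine mem_ofPrime_iff.2 ⟨s, a, ?_, inv_div _ _⟩
    rw [Ideal.mem_comap, mem_maximalIdeal_iff_inv, not_or, not_not]
    refine ⟨fun H => ha (congrArg Subtype.val H), ?_⟩
    have := mul_mem hz' (hC s hs)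
    rwa [inv_div, div_mul_eq_mul_div, mul_inv_cancel₀ hs0, one_div] at this

theorem chart_le_iff {A : LocalSubring F} {x : F} {S : Subring F} :
    chart A x ≤ S ↔ A.toSubring ≤ S ∧ ∀ a ∈ maximalIdeal A.toSubring, (a : F) / x ∈ S := by
  rw [chart, Subring.closure_le, Set.union_subset_iff]
  refine and_congr Iff.rfl ⟨fun h a ha => h ⟨a, ha, rfl⟩, ?_⟩
  rintro h _ ⟨a, ha, rfl⟩
  exact h a ha

theorem div_mem_chart (A : LocalSubring F) (x : F) {a : A.toSubring}
    (ha : a ∈ maximalIdeal A.toSubring) : (a : F) / x ∈ chart A x :=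
  (chart_le_iff.1 le_rfl).2 a ha

theorem isLocalBlowup_ofPrime_comap {A C : LocalSubring F} (h : A ≤ C) {x : A.toSubring}
    (hx : x ∈ maximalIdeal A.toSubring) (hx0 : x ≠ 0) (hc : chart A (x : F) ≤ C.toSubring) :
    IsLocalBlowup A (LocalSubring.ofPrime (chart A (x : F))
      ((maximalIdeal C.toSubring).comap (Subring.inclusion hc))) := by
  refine ⟨x, hx, hx0, _, inferInstance, ?_, rfl⟩
  ext z
  exact mem_maximalIdeal_of_le h

theorem IsLocalBlowup.exists_div_mem {A B : LocalSubring F} (h : IsLocalBlowup A B) :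
    ∃ x ∈ maximalIdeal A.toSubring, x ≠ 0 ∧
      ∀ a ∈ maximalIdeal A.toSubring, (a : F) / x ∈ B.toSubring := by
  obtain ⟨x, hx, hx0, q, hq, -, rfl⟩ := h
  exact ⟨x, hx, hx0, fun a ha => LocalSubring.le_ofPrime _ q (div_mem_chart A x ha)⟩

theorem IsLocalBlowup.le {A B : LocalSubring F} (h : IsLocalBlowup A B) : A ≤ B := by
  obtain ⟨x, hx, hx0, q, hq, hqA, rfl⟩ := h
  refine le_iff_inv_mem.2 ⟨(le_chart A x).trans (LocalSubring.le_ofPrime _ q), fun z hz hz' => ?_⟩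
  by_contra hzA
  have hzm : (⟨z, hz⟩ : A.toSubring) ∈ maximalIdeal A.toSubring :=
    mem_maximalIdeal_iff_inv.2 (.inr hzA)
  rw [← hqA, Ideal.mem_comap, ← mem_maximalIdeal_ofPrime_iff, mem_maximalIdeal_iff_inv] at hzm
  obtain h0 | h0 := hzm
  · have h0 : z = 0 := congrArg Subtype.val h0
    simp [h0] at hzA
  · exact h0 hz'

/-- If `x`, `x'` define the two charts, then `x / x'` lies in `B'` and its inverse in `B`, so it is
a unit of `C` and, by domination, of `B'`. Hence `B'` contains the chart of `x`; the denominators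
used in `B` are units of `C`, hence of `B'`. -/
theorem IsLocalBlowup.le_of_le {A B B' C : LocalSubring F} (h : IsLocalBlowup A B)
    (h' : IsLocalBlowup A B') (hB : B ≤ C) (hB' : B' ≤ C) :
    B.toSubring ≤ B'.toSubring := by
  have hAB' := h'.le
  obtain ⟨x, hx, hx0, q, hq, -, rfl⟩ := h
  obtain ⟨x', hx', hx0', hdiv⟩ := h'.exists_div_mem
  have hx0F : (x : F) ≠ 0 := fun H => hx0 (Subtype.ext H)
  have hx0F' : (x' : F) ≠ 0 := fun H => hx0' (Subtype.ext H)
  have hinv : ((x : F) / x')⁻¹ ∈ B'.toSubring := by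
    refine (le_iff_inv_mem.1 hB').2 _ (hdiv x hx) ?_
    rw [inv_div]
    exact hB.1 (LocalSubring.le_ofPrime _ q (div_mem_chart A x hx'))
  have hchart : chart A (x : F) ≤ B'.toSubring := by
    refine chart_le_iff.2 ⟨hAB'.1, fun a ha => ?_⟩
    have := mul_mem (hdiv a ha) hinv
    rwa [inv_div, div_mul_div_cancel₀ hx0F'] at this
  intro z hz
  obtain ⟨a, s, hs, rfl⟩ := mem_ofPrime_iff.1 hz
  rw [div_eq_mul_inv]
  exact mul_mem (hchart a.2) ((le_iff_inv_mem.1 hB').2 _ (hchart s.2) (hB.1 (inv_mem_ofPrime hs)))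

/-- A local ring dominates at most one local point blowing up of `A`. -/
theorem IsLocalBlowup.eq_of_le {A B B' C : LocalSubring F} (h : IsLocalBlowup A B)
    (h' : IsLocalBlowup A B') (hB : B ≤ C) (hB' : B' ≤ C) : B = B' :=
  LocalSubring.toSubring_injective (le_antisymm (h.le_of_le h' hB hB') (h'.le_of_le h hB' hB))

/-- A Noetherian local ring whose maximal ideal is principal or generated by a regular pair. -/
def IsRegularOrPrincipal (A : LocalSubring F) : Prop :=
  IsNoetherianRing A.toSubring ∧ ((maximalIdeal A.toSubring).IsPrincipal ∨
    ∃ x y : A.toSubring, IsRegularPair x y)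

theorem chart_le_of_isRegularPair {A C : LocalSubring F} (h : A ≤ C) {x y : A.toSubring}
    (hxy : IsRegularPair x y) (hd : (y : F) / x ∈ C.toSubring) : chart A (x : F) ≤ C.toSubring := by
  refine chart_le_iff.2 ⟨h.1, fun a ha => ?_⟩
  rw [hxy.span_eq] at ha
  obtain ⟨b, c, rfl⟩ := Ideal.mem_span_pair.1 ha
  have hx0 : (x : F) ≠ 0 := fun H => hxy.prime.ne_zero (Subtype.ext H)
  have : ((b * x + c * y : A.toSubring) : F) / x = b + c * (y / x) := by
    push_cast
    field_simp
  rw [this]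
  exact add_mem (h.1 b.2) (mul_mem (h.1 c.2) hd)

open Polynomial in
-- The chart is `A[y / x]`, hence Noetherian, and its quotient by `x` is a polynomial ring over a
-- field, hence a principal ideal domain.
theorem isRegularOrPrincipal_ofPrime_chart {A : LocalSubring F} [IsNoetherianRing A.toSubring]
    {x y : A.toSubring} (hxy : IsRegularPair x y) (q : Ideal (chart A (x : F))) [q.IsPrime]
    (hxq : Subring.inclusion (le_chart A (x : F)) x ∈ q) :
    IsRegularOrPrincipal (LocalSubring.ofPrime (chart A (x : F)) q) := by
  let : Algebra A.toSubring (chart A (x : F)) := (Subring.inclusion (le_chart A (x : F))).toAlgebra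
  have : IsScalarTower A.toSubring (chart A (x : F)) F := .of_algebraMap_eq fun _ => rfl
  have : FaithfulSMul A.toSubring (chart A (x : F)) :=
    (faithfulSMul_iff_algebraMap_injective _ _).2 (Subring.inclusion_injective _)
  have hx0 : (x : F) ≠ 0 := fun H => hxy.prime.ne_zero (Subtype.ext H)
  let t : chart A (x : F) := ⟨(y : F) / x, div_mem_chart A x hxy.right_mem⟩
  have ht : algebraMap A.toSubring (chart A (x : F)) x * t = algebraMap _ _ y :=
    Subtype.ext (mul_div_cancel₀ _ hx0)
  have hs : Function.Surjective (aeval (R := A.toSubring) t) := by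
    have hle : chart A (x : F) ≤ (aeval (R := A.toSubring) (t : F)).range.toSubring := by
      refine chart_le_iff.2 ⟨fun a ha => ⟨C ⟨a, ha⟩, aeval_C _ _⟩, fun a ha => ?_⟩
      rw [hxy.span_eq] at ha
      obtain ⟨b, c, rfl⟩ := Ideal.mem_span_pair.1 ha
      refine ⟨C b + C c * X, ?_⟩
      change aeval (t : F) (C b + C c * X) = ((b * x + c * y : A.toSubring) : F) / x
      rw [map_add, map_mul, aeval_C, aeval_C, aeval_X]
      change (b : F) + c * (y / x) = ((b * x + c * y : A.toSubring) : F) / x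
      push_cast
      field_simp
    intro z
    obtain ⟨P, hP⟩ := hle z.2
    exact ⟨P, Subtype.ext ((aeval_algebraMap_apply F t P).symm.trans hP)⟩
  have hN : IsNoetherianRing (chart A (x : F)) :=
    isNoetherianRing_of_surjective _ _ (aeval (R := A.toSubring) t).toRingHom hs
  refine ⟨IsLocalization.isNoetherianRing q.primeCompl _ hN, ?_⟩
  let e := hxy.quotientEquiv ht hs
  have : IsDomain (chart A (x : F) ⧸ Ideal.span {algebraMap _ (chart A (x : F)) x}) :=
    e.toMulEquiv.isDomain _
  have : IsPrincipalIdealRing (chart A (x : F) ⧸ Ideal.span {algebraMap _ (chart A (x : F)) x}) :=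
    IsPrincipalIdealRing.of_surjective e.symm.toRingHom e.symm.surjective
  exact (isPrincipal_or_isRegularPair_of_isLocalization (z := algebraMap _ (chart A (x : F)) x)
    (fun H => hx0 (congrArg Subtype.val H)) q hxq _).imp_right fun ⟨g, hg⟩ => ⟨_, g, hg⟩

/-- Uniqueness, applied with `C = B`, allows a change of chart: the parameter defining `B` may be
replaced by `x`. -/
theorem IsLocalBlowup.eq_ofPrime_chart {A B : LocalSubring F} (h : IsLocalBlowup A B)
    {x y : A.toSubring} (hxy : IsRegularPair x y) (hd : (y : F) / x ∈ B.toSubring) :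
    B = LocalSubring.ofPrime (chart A (x : F)) ((maximalIdeal B.toSubring).comap
      (Subring.inclusion (chart_le_of_isRegularPair h.le hxy hd))) :=
  h.eq_of_le (isLocalBlowup_ofPrime_comap h.le hxy.left_mem hxy.prime.ne_zero _) le_rfl
    (ofPrime_comap_le _)

theorem IsLocalBlowup.div_mem_or_div_mem {A B : LocalSubring F} (h : IsLocalBlowup A B)
    {x y : A.toSubring} (hxy : maximalIdeal A.toSubring = Ideal.span {x, y}) :
    (y : F) / x ∈ B.toSubring ∨ (x : F) / y ∈ B.toSubring := by
  obtain ⟨z, hz, hz0, hd⟩ := h.exists_div_mem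
  have hz0F : (z : F) ≠ 0 := fun H => hz0 (Subtype.ext H)
  have hx := hd x (hxy ▸ Ideal.subset_span (by simp))
  have hy := hd y (hxy ▸ Ideal.subset_span (by simp))
  obtain ⟨b, c, hbc⟩ := Ideal.mem_span_pair.1 (hxy ▸ hz)
  have hbcF : (b : F) * x + c * y = z := congrArg Subtype.val hbc
  let b' : B.toSubring := ⟨b, h.le.1 b.2⟩
  let c' : B.toSubring := ⟨c, h.le.1 c.2⟩
  -- Dividing `z = b x + c y` by `z`; in the local ring `B` one summand is a unit, so `x / z` or `y
  -- / z` is.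
  have h1 : b' * ⟨_, hx⟩ + c' * ⟨_, hy⟩ = 1 := Subtype.ext <| by
    change (b : F) * (x / z) + c * (y / z) = 1
    rw [← mul_div_assoc, ← mul_div_assoc, ← add_div, hbcF, div_self hz0F]
  obtain hu | hu := isUnit_or_isUnit_of_add_one h1
  · left
    have := mul_mem hy (isUnit_iff_inv_mem.1 (isUnit_of_mul_isUnit_right hu)).2
    rwa [inv_div, div_mul_div_cancel₀ hz0F] at this
  · right
    have := mul_mem hx (isUnit_iff_inv_mem.1 (isUnit_of_mul_isUnit_right hu)).2
    rwa [inv_div, div_mul_div_cancel₀ hz0F] at this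

theorem IsLocalBlowup.isRegularOrPrincipal {A B : LocalSubring F} (h : IsLocalBlowup A B)
    (hA : IsRegularOrPrincipal A) (hp : ¬ (maximalIdeal A.toSubring).IsPrincipal) :
    IsRegularOrPrincipal B := by
  obtain ⟨hN, hA⟩ := hA
  obtain ⟨x, y, hxy⟩ := hA.resolve_left hp
  have key : ∀ {x y : A.toSubring}, IsRegularPair x y → (y : F) / x ∈ B.toSubring →
      IsRegularOrPrincipal B := fun {x y} hxy hd => by
    rw [h.eq_ofPrime_chart hxy hd]
    exact isRegularOrPrincipal_ofPrime_chart hxy _ ((mem_maximalIdeal_of_le h.le).2 hxy.left_mem)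
  obtain hd | hd := h.div_mem_or_div_mem hxy.span_eq
  · exact key hxy hd
  · exact key hxy.symm hd

/-- A valuation ring that dominates `A` dominates a local point blowing up of `A`. -/
theorem exists_isLocalBlowup_le {A : LocalSubring F} (hA : IsRegularOrPrincipal A)
    (hp : ¬ (maximalIdeal A.toSubring).IsPrincipal) {V : ValuationSubring F}
    (hV : A ≤ V.toLocalSubring) : ∃ B, IsLocalBlowup A B ∧ B ≤ V.toLocalSubring := by
  obtain ⟨hN, hA⟩ := hA
  obtain ⟨x, y, hxy⟩ := hA.resolve_left hp
  have key : ∀ {x y : A.toSubring}, IsRegularPair x y → (y : F) / x ∈ V →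
      ∃ B, IsLocalBlowup A B ∧ B ≤ V.toLocalSubring := fun {x y} hxy hd =>
    have hc := chart_le_of_isRegularPair hV hxy hd
    ⟨_, isLocalBlowup_ofPrime_comap hV hxy.left_mem hxy.prime.ne_zero hc, ofPrime_comap_le hc⟩
  obtain hd | hd := V.mem_or_inv_mem ((y : F) / x)
  · exact key hxy hd
  · rw [inv_div] at hd
    exact key hxy.symm hd

end Subrings

/-! ### Length bounds and residually transcendental extensions. -/

section Union

open Polynomial
open scoped Pointwise

theorem length_quotient_add_le_of_strictAnti {B : Type*} [CommRing B] (c : ℕ → Ideal B) (n : ℕ)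
    (hc : ∀ j < n, c (j + 1) < c j) :
    Module.length B (B ⧸ c 0) + n ≤ Module.length B (B ⧸ c n) := by
  induction n with
  | zero => simp
  | succ n ih =>
    refine le_trans ?_ (?_ : Module.length B (B ⧸ c n) + 1 ≤ _)
    · push_cast
      rw [← add_assoc]
      gcongr
      exact ih fun j hj => hc j (by omega)
    · rw [Module.length_quotient, Module.length_quotient]
      exact Order.coheight_add_one_le (hc n (by omega))

/-- In a one-dimensional Noetherian domain, the length of a chain of ideals between `I` and `b I` is
bounded independently of `I`. -/
theorem le_ord_of_strictAnti {B : Type*} [CommRing B] [IsDomain B] [IsNoetherianRing B]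
    [Ring.KrullDimLE 1 B] {b : B} (hb : b ≠ 0) (c : ℕ → Ideal B) (n : ℕ)
    (hc : ∀ j < n, c (j + 1) < c j) (h0 : c 0 ≠ ⊥) (hle : b • c 0 ≤ c n) :
    (n : ℕ∞) ≤ Ring.ord B b := by
  -- From `0 → B / I → B / b I → B / b → 0` with `I = c 0`: the lengths of `B / b I` and `B / I`
  -- differ by the order of `b`. The length of `B / I` is finite, so it can be cancelled.
  have hadd := Module.length_eq_add_of_exact (Ideal.mulQuot b (c 0)) (Ideal.quotOfMul b (c 0))
    (Ideal.mulQuot_injective _ (mem_nonZeroDivisors_of_ne_zero hb))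
    (Ideal.quotOfMul_surjective _) (Ideal.exact_mulQuot_quotOfMul _)
  have hsur : Module.length B (B ⧸ c n) ≤ Module.length B (B ⧸ b • c 0) :=
    Module.length_le_of_surjective (Submodule.factor hle) (Submodule.factor_surjective hle)
  have hfin : Module.length B (B ⧸ c 0) ≠ ⊤ := by
    obtain ⟨d, hd, hd0⟩ := Submodule.exists_mem_ne_zero_of_ne_bot h0
    have hle : Ideal.span {d} ≤ c 0 := (Ideal.span_singleton_le_iff_mem _).2 hd
    refine ne_top_of_le_ne_top (Ring.ord_ne_top (mem_nonZeroDivisors_of_ne_zero hd0)) ?_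
    exact Module.length_le_of_surjective (Submodule.factor hle) (Submodule.factor_surjective hle)
  have := ((length_quotient_add_le_of_strictAnti c n hc).trans hsur).trans_eq hadd
  exact (ENat.add_le_add_iff_left hfin).1 this

variable {F : Type u} [Field F]

/-- A one-dimensional Noetherian domain `B` bounds the length of a divisor chain of `b ∈ B` in any
ring between `B` and its field of fractions. -/
theorem le_ord_of_div_mem {B W : Subring F} [IsNoetherianRing B] [Ring.KrullDimLE 1 B]
    [IsFractionRing B F] (hBW : B ≤ W) {b : B} (hb : b ≠ 0) (p : ℕ → F) (n : ℕ)
    (h0 : p 0 = 1) (hp0 : ∀ j, p j ≠ 0)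
    (hstep : ∀ j < n, p (j + 1) / p j ∈ W) (hnot : ∀ j < n, p j / p (j + 1) ∉ W)
    (hbp : (b : F) / p n ∈ W) : (n : ℕ∞) ≤ Ring.ord B b := by
  obtain ⟨⟨d, hd⟩, hdp⟩ := IsLocalization.exist_integer_multiples (nonZeroDivisors B)
    (Finset.range (n + 1)) p
  have hd0 : (d : F) ≠ 0 := fun H => nonZeroDivisors.ne_zero hd (Subtype.ext H)
  have hdp' : ∀ j, ∃ e : B, j ≤ n → (e : F) = d * p j := fun j => by
    by_cases hj : j ≤ n
    · obtain ⟨e, he⟩ := hdp j (Finset.mem_range.2 (Nat.lt_succ_of_le hj))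
      exact ⟨e, fun _ => he⟩
    · exact ⟨0, fun h => absurd h hj⟩
  choose e he using hdp'
  -- `J j` is the trace on `B` of the fractional ideal `d p_j W`, where `d` clears the denominators
  -- of `p 0, …, p n`. The element `e j = d p_j` witnesses that the chain drops at step `j`.
  let J (j : ℕ) : Ideal B :=
    { carrier := {u | (u : F) / (d * p j) ∈ W}
      add_mem' := fun {u v} hu hv => by
        have : ((u + v : B) : F) / (d * p j) = u / (d * p j) + v / (d * p j) := by
          rw [Subring.coe_add, add_div]
        rw [Set.mem_ofPred_eq, this]
        exact add_mem hu hv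
      zero_mem' := by simp
      smul_mem' := fun r u hu => by
        have : ((r • u : B) : F) / (d * p j) = r * (u / (d * p j)) := by
          rw [smul_eq_mul, Subring.coe_mul, mul_div_assoc]
        rw [Set.mem_ofPred_eq, this]
        exact mul_mem (hBW r.2) hu }
  have hmem : ∀ (j : ℕ) (u : B), u ∈ J j ↔ (u : F) / (d * p j) ∈ W := fun _ _ => Iff.rfl
  let I : Ideal B := Ideal.span (e '' Set.Iic n)
  have heI : ∀ j ≤ n, e j ∈ I := fun j hj => Ideal.subset_span ⟨j, hj, rfl⟩
  have heJ : ∀ j ≤ n, e j ∈ J j := fun j hj => by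
    rw [hmem, he j hj, div_self (mul_ne_zero hd0 (hp0 j))]
    exact one_mem W
  refine le_ord_of_strictAnti hb (fun j => I ⊓ J j) n (fun j hj => ?_) ?_ ?_
  · refine lt_of_le_of_ne (inf_le_inf_left _ fun u hu => ?_) fun H => ?_
    · rw [hmem] at hu ⊢
      have := mul_mem hu (hstep j hj)
      have h1 := hp0 j
      have h2 := hp0 (j + 1)
      have h3 : (u : F) / (d * p (j + 1)) * (p (j + 1) / p j) = u / (d * p j) := by field_simp
      exact h3 ▸ this
    · have : e j ∈ I ⊓ J (j + 1) := H ▸ ⟨heI j hj.le, heJ j hj.le⟩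
      have := (hmem _ _).1 this.2
      rw [he j hj.le, mul_div_mul_left _ _ hd0] at this
      exact hnot j hj this
  · refine (Submodule.ne_bot_iff _).2 ⟨e 0, ⟨heI 0 n.zero_le, heJ 0 n.zero_le⟩, fun H => ?_⟩
    have := he 0 n.zero_le
    rw [H, h0, mul_one] at this
    exact hd0 this.symm
  · intro v hv
    obtain ⟨u, hu, rfl⟩ := hv
    refine ⟨I.mul_mem_left b hu.1, (hmem _ _).2 ?_⟩
    have h2 := hp0 n
    have := mul_mem hbp ((hmem _ _).1 hu.2)
    have h3 : (b : F) / p n * (u / (d * p 0)) = ((b * u : B) : F) / (d * p n) := by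
      rw [h0]
      push_cast
      field_simp
    exact h3 ▸ this

/-- If `S` is normal and neither `f` nor `f⁻¹` is in `S`, then `f` is residually transcendental. -/
theorem coeff_mem_maximalIdeal_of_aeval_eq_zero {S : LocalSubring F}
    [IsIntegrallyClosed S.toSubring] [IsFractionRing S.toSubring F] {f : F}
    (hf : f ∉ S.toSubring) (hf' : f⁻¹ ∉ S.toSubring) (H : S.toSubring[X]) (hH : aeval f H = 0)
    (i : ℕ) : H.coeff i ∈ maximalIdeal S.toSubring := by
  have hf0 : f ≠ 0 := by
    rintro rfl
    exact hf (zero_mem _)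
  obtain ⟨n, hn⟩ : ∃ n, H.natDegree ≤ n := ⟨_, le_rfl⟩
  induction n generalizing H i with
  | zero =>
    rw [eq_C_of_natDegree_le_zero hn] at hH ⊢
    rw [aeval_C] at hH
    have : H.coeff 0 = 0 := Subtype.ext hH
    simp [this]
  | succ n ih =>
    by_cases hc : H.coeff (n + 1) = 0
    · refine ih H hH i ?_
      by_contra h
      have : H.natDegree = n + 1 := by omega
      rw [← this, coeff_natDegree, leadingCoeff_eq_zero] at hc
      simp [hc] at this
    have hdeg : H.natDegree = n + 1 := le_antisymm hn (le_natDegree_of_ne_zero hc)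
    -- Leading coefficient times `f` is integral over `S`, so it is some `d ∈ S`. As neither `f` nor
    -- `f⁻¹` is in `S`, neither the leading coefficient nor `d` is a unit.
    have hint := isIntegral_leadingCoeff_smul H f hH
    rw [leadingCoeff, hdeg] at hint
    obtain ⟨d, hd⟩ := IsIntegrallyClosed.isIntegral_iff.1 hint
    have hd : (d : F) = H.coeff (n + 1) * f := hd
    have hc0 : (H.coeff (n + 1) : F) ≠ 0 := fun h => hc (Subtype.ext h)
    have hcm : H.coeff (n + 1) ∈ maximalIdeal S.toSubring := by
      rw [mem_maximalIdeal_iff_inv]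
      refine .inr fun h => hf ?_
      have := mul_mem h d.2
      rwa [hd, inv_mul_cancel_left₀ hc0] at this
    have hdm : d ∈ maximalIdeal S.toSubring := by
      rw [mem_maximalIdeal_iff_inv]
      refine .inr fun h => hf' ?_
      have := mul_mem h (H.coeff (n + 1)).2
      rwa [hd, mul_inv, mul_comm, mul_inv_cancel_left₀ hc0] at this
    -- Trading the top term for `d X ^ n` keeps the value at `f`, lowers the degree bound and
    -- changes coefficients only by elements of the maximal ideal.
    have key := ih (H - C (H.coeff (n + 1)) * X ^ (n + 1) + C d * X ^ n) (by
      rw [map_add, map_sub, hH, map_mul, map_mul, aeval_C, aeval_C, map_pow, map_pow, aeval_X]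
      change 0 - (H.coeff (n + 1) : F) * f ^ (n + 1) + (d : F) * f ^ n = 0
      rw [hd]
      ring) i (by
      rw [natDegree_le_iff_coeff_eq_zero]
      intro N hN
      rw [coeff_add, coeff_sub, coeff_C_mul_X_pow, coeff_C_mul_X_pow, if_neg hN.ne', add_zero]
      by_cases hN' : N = n + 1
      · simp [hN']
      · rw [if_neg hN', sub_zero]
        exact coeff_eq_zero_of_natDegree_lt (by omega))
    rw [coeff_add, coeff_sub, coeff_C_mul_X_pow, coeff_C_mul_X_pow] at key
    have h1 : (if i = n + 1 then H.coeff (n + 1) else 0) ∈ maximalIdeal S.toSubring := by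
      split_ifs
      exacts [hcm, zero_mem _]
    have h2 : (if i = n then d else 0) ∈ maximalIdeal S.toSubring := by
      split_ifs
      exacts [hdm, zero_mem _]
    have h3 := (maximalIdeal S.toSubring).add_mem ((Ideal.add_mem_iff_left _ h2).1 key) h1
    rwa [sub_add_cancel] at h3

/-- The localization `S[f]_{𝔪 S[f]}`, for `f` residually transcendental over `S`. -/
theorem exists_gauss_extension (S : LocalSubring F) (f : F)
    (hf : ∀ H : S.toSubring[X], aeval f H = 0 → ∀ i, H.coeff i ∈ maximalIdeal S.toSubring) :
    ∃ W : LocalSubring F, ∃ h : S.toSubring ≤ W.toSubring,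
      (∀ z, z ∈ W.toSubring ↔ ∃ P Q : S.toSubring[X],
        (∃ i, Q.coeff i ∉ maximalIdeal S.toSubring) ∧ z = aeval f P / aeval f Q) ∧
      maximalIdeal W.toSubring = (maximalIdeal S.toSubring).map (Subring.inclusion h) ∧
      (IsNoetherianRing S.toSubring → IsNoetherianRing W.toSubring) := by
  let T : Subring F := (aeval (R := S.toSubring) f).toRingHom.range
  let φ : S.toSubring[X] →+* T := (aeval (R := S.toSubring) f).toRingHom.rangeRestrict
  have hφ : Function.Surjective φ := RingHom.rangeRestrict_surjective _
  have hφv : ∀ P, (φ P : F) = aeval f P := fun _ => rfl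
  let m : Ideal S.toSubring[X] := (maximalIdeal S.toSubring).map C
  have hm : m.IsPrime := Ideal.isPrime_map_C_of_isPrime
  -- Residual transcendence is what makes `𝔪 S[f]` prime, with membership readable on the
  -- coefficients of any representing polynomial.
  have hker : RingHom.ker φ ≤ m := fun P hP => Ideal.mem_map_C_iff.2 <|
    hf P ((hφv P).symm.trans (congrArg Subtype.val hP))
  let q : Ideal T := m.map φ
  have hq : q.IsPrime := Ideal.map_isPrime_of_surjective hφ hker
  have hqm : ∀ P, φ P ∈ q ↔ ∀ i, P.coeff i ∈ maximalIdeal S.toSubring := fun P => by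
    rw [← Ideal.mem_map_C_iff, ← Ideal.mem_comap, Ideal.comap_map_of_surjective _ hφ,
      ← RingHom.ker_eq_comap_bot, sup_eq_left.2 hker]
  have hST : S.toSubring ≤ T := fun a ha => ⟨C ⟨a, ha⟩, aeval_C _ _⟩
  refine ⟨LocalSubring.ofPrime T q, hST.trans (LocalSubring.le_ofPrime T q), fun z => ?_, ?_, ?_⟩
  · rw [mem_ofPrime_iff]
    constructor
    · rintro ⟨a, s, hs, rfl⟩
      obtain ⟨P, rfl⟩ := hφ a
      obtain ⟨Q, rfl⟩ := hφ s
      rw [hqm, not_forall] at hs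
      exact ⟨P, Q, hs, rfl⟩
    · rintro ⟨P, Q, hQ, rfl⟩
      exact ⟨φ P, φ Q, by rwa [hqm, not_forall], rfl⟩
  · rw [← IsLocalization.AtPrime.map_eq_maximalIdeal q, Ideal.map_map, Ideal.map_map]
    congr 1
    ext a
    exact aeval_C f a
  · intro hS
    have hT : IsNoetherianRing T := isNoetherianRing_of_surjective _ _ φ hφ
    exact IsLocalization.isNoetherianRing q.primeCompl _ hT

end Union

/-! ### Infinite sequences: every `f` or its inverse is eventually reached. -/

section UnionOfSequence

open Polynomial

variable {F : Type u} [Field F]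

theorem isFractionRing_of_le {S T : Subring F} (h : S ≤ T) [IsFractionRing S F] :
    IsFractionRing T F := by
  refine IsFractionRing.of_field _ _ fun z => ?_
  obtain ⟨a, b, -, rfl⟩ := IsFractionRing.div_surjective (A := S) z
  exact ⟨⟨a, h a.2⟩, ⟨b, h b.2⟩, rfl⟩

/-- The maximal ideal is minimal over `(b)`, so Krull's principal ideal theorem bounds its height.
-/
theorem krullDimLE_one_of_pow_le {B : Type*} [CommRing B] [IsLocalRing B] [IsNoetherianRing B]
    {b : B} (hb : b ∈ maximalIdeal B) {N : ℕ} (h : maximalIdeal B ^ N ≤ Ideal.span {b}) :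
    Ring.KrullDimLE 1 B := by
  have hmin : maximalIdeal B ∈ (Ideal.span {b}).minimalPrimes :=
    ⟨⟨inferInstance, (Ideal.span_singleton_le_iff_mem _).2 hb⟩, fun p hp _ =>
      have := hp.1
      Ideal.IsPrime.le_of_pow_le (h.trans hp.2)⟩
  have hht := Ideal.height_le_one_of_isPrincipal_of_mem_minimalPrimes _ _ hmin
  rw [Ring.KrullDimLE, Order.krullDimLE_iff]
  change ringKrullDim B ≤ _
  rw [← maximalIdeal_height_eq_ringKrullDim]
  exact_mod_cast hht

/-- A nonmaximal prime containing both `a` and `b` would be principal, and its generator would be a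
common nonunit divisor. -/
theorem IsRegularPair.exists_pow_le_span_pair {A : Type*} [CommRing A] [IsLocalRing A] [IsDomain A]
    [IsNoetherianRing A] {x y a b : A} (h : IsRegularPair x y) (hab : IsRelPrime a b) :
    ∃ N : ℕ, maximalIdeal A ^ N ≤ Ideal.span {a, b} := by
  refine Ideal.exists_pow_le_of_le_radical_of_fg ?_ (IsNoetherian.noetherian _)
  rw [Ideal.radical_eq_sInf]
  refine le_sInf fun p ⟨hp, hpp⟩ => ?_
  obtain rfl | ⟨g, hg⟩ := h.eq_maximalIdeal_or_isPrincipal p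
  · exact le_rfl
  · have hpg : p = Ideal.span {g} := hg
    have ha : a ∈ p := hp (Ideal.subset_span (by simp))
    have hb : b ∈ p := hp (Ideal.subset_span (by simp))
    rw [hpg, Ideal.mem_span_singleton] at ha hb
    exact absurd (hpg.trans (Ideal.span_singleton_eq_top.2 (hab ha hb))) hpp.ne_top

theorem IsRegularOrPrincipal.exists_isRegularPair {A : LocalSubring F}
    (hA : IsRegularOrPrincipal A) (hp : ¬ (maximalIdeal A.toSubring).IsPrincipal) :
    ∃ x y : A.toSubring, IsRegularPair x y :=
  hA.2.resolve_left hp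

theorem IsRegularOrPrincipal.isIntegrallyClosed {A : LocalSubring F}
    (hA : IsRegularOrPrincipal A) (hp : ¬ (maximalIdeal A.toSubring).IsPrincipal) :
    IsIntegrallyClosed A.toSubring := by
  obtain ⟨x, y, hxy⟩ := hA.exists_isRegularPair hp
  have := hA.1
  have := hxy.uniqueFactorizationMonoid
  infer_instance

/-- Otherwise the denominator of `f` would have order at least `n`, for all `n`, in one fixed
Noetherian domain of dimension at most one. -/
theorem exists_mem_or_inv_mem (A : ℕ → LocalSubring F)
    (hb : ∀ i, IsLocalBlowup (A i) (A (i + 1))) (hr : ∀ i, IsRegularOrPrincipal (A i))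
    (hp : ∀ i, ¬ (maximalIdeal (A i).toSubring).IsPrincipal) [IsFractionRing (A 0).toSubring F]
    (f : F) : ∃ i, f ∈ (A i).toSubring ∨ f⁻¹ ∈ (A i).toSubring := by
  by_contra! hf
  have hmono : Monotone A := monotone_nat_of_le_succ fun i => (hb i).le
  choose x hx hx0 hdiv using fun i => (hb i).exists_div_mem
  have hx0F : ∀ i, (x i : F) ≠ 0 := fun i H => hx0 i (Subtype.ext H)
  let p : ℕ → F := fun n => ∏ j ∈ Finset.range n, (x j : F)
  have hps : ∀ n, p (n + 1) = p n * x n := fun n => Finset.prod_range_succ _ _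
  have hp0 : ∀ n, p n ≠ 0 := fun n => Finset.prod_ne_zero_iff.2 fun j _ => hx0F j
  have hN := (hr 0).1
  obtain ⟨x₀, y₀, hxy⟩ := (hr 0).exists_isRegularPair (hp 0)
  have := hxy.uniqueFactorizationMonoid
  obtain ⟨a, ⟨b, hb0⟩, hab, hfab⟩ := IsFractionRing.exists_reduced_fraction (A 0).toSubring f
  have hb0 : b ≠ 0 := nonZeroDivisors.ne_zero hb0
  have hb0F : (b : F) ≠ 0 := fun H => hb0 (Subtype.ext H)
  have hfab : f = a / b := by
    rw [← hfab, IsFractionRing.mk'_eq_div]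
    rfl
  -- The two members of the pair stay in the maximal ideals after division by `p i`.
  have hmax : ∀ i (u w : F), u / w = f → ∀ (hu : u ∈ (A i).toSubring) (hw : w ∈ (A i).toSubring),
      (⟨u, hu⟩ : (A i).toSubring) ∈ maximalIdeal (A i).toSubring ∧
      (⟨w, hw⟩ : (A i).toSubring) ∈ maximalIdeal (A i).toSubring := by
    intro i u w huw hu hw
    refine ⟨mem_maximalIdeal_iff_inv.2 (.inr fun h => (hf i).2 ?_),
      mem_maximalIdeal_iff_inv.2 (.inr fun h => (hf i).1 ?_)⟩
    · rw [← huw, inv_div, div_eq_mul_inv]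
      exact mul_mem hw h
    · rw [← huw, div_eq_mul_inv]
      exact mul_mem hu h
  have hquot : ∀ i, (a : F) / p i / ((b : F) / p i) = f := fun i => by
    rw [div_div_div_cancel_right₀ (hp0 i), hfab]
  have hmem : ∀ i, (a : F) / p i ∈ (A i).toSubring ∧ (b : F) / p i ∈ (A i).toSubring := by
    intro i
    induction i with
    | zero => simp [p]
    | succ i ih =>
      obtain ⟨h1, h2⟩ := hmax i _ _ (hquot i) ih.1 ih.2
      rw [hps, ← div_div, ← div_div]
      exact ⟨hdiv i _ h1, hdiv i _ h2⟩
  have hgauss : ∀ i, ∀ H : (A i).toSubring[X], aeval f H = 0 →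
      ∀ j, H.coeff j ∈ maximalIdeal (A i).toSubring := fun i H hH j => by
    have := (hr i).isIntegrallyClosed (hp i)
    have : IsFractionRing (A i).toSubring F := isFractionRing_of_le (hmono i.zero_le).1
    exact coeff_mem_maximalIdeal_of_aeval_eq_zero (hf i).1 (hf i).2 H hH j
  obtain ⟨B, hAB, hB, hBm, hBN⟩ := exists_gauss_extension (A 0) f (hgauss 0)
  have hBN := hBN hN
  have : IsFractionRing B.toSubring F := isFractionRing_of_le hAB
  have hfB : f ∈ B.toSubring := (hB f).2 ⟨X, 1, ⟨0, by simp⟩, by simp⟩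
  let b' : B.toSubring := Subring.inclusion hAB b
  have hbm : b ∈ maximalIdeal (A 0).toSubring := (hmax 0 a b hfab.symm a.2 b.2).2
  have hbB : b' ∈ maximalIdeal B.toSubring := hBm ▸ Ideal.mem_map_of_mem _ hbm
  obtain ⟨N, hNle⟩ := hxy.exists_pow_le_span_pair hab
  -- A power of the maximal ideal of `A 0` lies in `(a, b)`, and in `B` this ideal is `(b)` because
  -- `a = f b`.
  have hdim : Ring.KrullDimLE 1 B.toSubring := by
    refine krullDimLE_one_of_pow_le hbB (N := N) ?_
    rw [hBm, ← Ideal.map_pow]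
    refine (Ideal.map_mono hNle).trans ?_
    rw [Ideal.map_span, Ideal.span_le]
    rintro _ ⟨z, rfl | rfl, rfl⟩
    · refine Ideal.mem_span_singleton'.2 ⟨⟨f, hfB⟩, Subtype.ext ?_⟩
      change f * (b : F) = z
      rw [hfab, div_mul_cancel₀ _ hb0F]
    · exact Ideal.mem_span_singleton_self _
  have hb'0 : b' ≠ 0 := fun H => hb0F (congrArg Subtype.val H)
  have hbound : ∀ n : ℕ, (n : ℕ∞) ≤ Ring.ord B.toSubring b' := by
    intro n
    obtain ⟨W, hAW, hW, hWm, -⟩ := exists_gauss_extension (A n) f (hgauss n)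
    have hlift : ∀ P : (A 0).toSubring[X],
        aeval f (P.map (Subring.inclusion (hmono n.zero_le).1)) = aeval f P := fun P => by
      rw [aeval_def, aeval_def, eval₂_map]
      rfl
    -- A coefficient outside the maximal ideal of `A 0` remains outside that of `A n`, by
    -- domination.
    have hBW : B.toSubring ≤ W.toSubring := by
      intro z hz
      obtain ⟨P, Q, ⟨i, hi⟩, rfl⟩ := (hB z).1 hz
      refine (hW _).2 ⟨P.map (Subring.inclusion (hmono n.zero_le).1),
        Q.map (Subring.inclusion (hmono n.zero_le).1), ⟨i, ?_⟩, ?_⟩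
      · rwa [coeff_map, mem_maximalIdeal_of_le (hmono n.zero_le)]
      · rw [hlift, hlift]
    have hquo : ∀ j, p (j + 1) / p j = x j := fun j => by
      rw [hps, mul_div_cancel_left₀ _ (hp0 j)]
    refine le_ord_of_div_mem hBW hb'0 p n (by simp [p]) hp0 (fun j hj => ?_) (fun j hj => ?_)
      (hAW (hmem n).2)
    · rw [hquo]
      exact hAW ((hmono hj.le).1 (x j).2)
    -- Each `x j` stays a nonunit in `W`, so the divisor chain `p 0, …, p n` is strict there.
    · have hxn : Subring.inclusion hAW (Subring.inclusion (hmono hj.le).1 (x j)) ∈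
          maximalIdeal W.toSubring :=
        hWm ▸ Ideal.mem_map_of_mem _ ((mem_maximalIdeal_of_le (hmono hj.le)).2 (hx j))
      rw [← inv_div, hquo]
      exact (mem_maximalIdeal_iff_inv.1 hxn).resolve_left fun H =>
        hx0F j (congrArg Subtype.val H)
  obtain ⟨k, hk⟩ := ENat.ne_top_iff_exists.1 (Ring.ord_ne_top (mem_nonZeroDivisors_of_ne_zero hb'0))
  have := hbound (k + 1)
  rw [← hk] at this
  have : k + 1 ≤ k := by exact_mod_cast this
  omega

end UnionOfSequence

/-! ### Valuations and simple sequences. -/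

section Correspondence

variable {R : Type v} {F : Type u} [CommRing R] [IsLocalRing R] [Field F] [Algebra R F]

theorem IsRegularPair.map_ringEquiv {A B : Type*} [CommRing A] [IsLocalRing A] [CommRing B]
    [IsLocalRing B] (e : A ≃+* B) {x y : A} (h : IsRegularPair x y) :
    IsRegularPair (e x) (e y) where
  span_eq := by
    rw [← map_ringEquiv_maximalIdeal e, h.span_eq, Ideal.map_span, Set.image_pair]
  prime := (MulEquiv.prime_iff e).2 h.prime
  not_dvd := fun H => h.not_dvd ((map_dvd_iff e).1 H)

variable (R F) in
/-- The initial ring of a simple sequence is isomorphic to `R`. -/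
def rangeEquiv [IsFractionRing R F] : R ≃+* (LocalSubring.range (algebraMap R F)).toSubring :=
  RingEquiv.ofBijective (algebraMap R F).rangeRestrict
    ⟨fun _ _ h => IsFractionRing.injective R F (congrArg Subtype.val h),
      RingHom.rangeRestrict_surjective _⟩

instance [IsFractionRing R F] :
    IsFractionRing (LocalSubring.range (algebraMap R F)).toSubring F := by
  refine IsFractionRing.of_field _ _ fun z => ?_
  obtain ⟨a, b, -, rfl⟩ := IsFractionRing.div_surjective (A := R) z
  exact ⟨rangeEquiv R F a, rangeEquiv R F b, rfl⟩

theorem range_le_iff [IsFractionRing R F] {V : ValuationSubring F} :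
    LocalSubring.range (algebraMap R F) ≤ V.toLocalSubring ↔
      (∀ r : R, V.valuation (algebraMap R F r) ≤ 1) ∧
        ∀ r ∈ maximalIdeal R, V.valuation (algebraMap R F r) < 1 := by
  constructor
  · intro h
    refine ⟨fun r => (V.valuation_le_one_iff _).2 (h.1 ⟨r, rfl⟩), fun r hr => ?_⟩
    have hr' : rangeEquiv R F r ∈
        maximalIdeal (LocalSubring.range (algebraMap R F)).toSubring := by
      rw [← map_ringEquiv_maximalIdeal (rangeEquiv R F)]
      exact Ideal.mem_map_of_mem _ hr
    exact (V.valuation_lt_one_iff ⟨_, h.1 ⟨r, rfl⟩⟩).1 ((mem_maximalIdeal_of_le h).2 hr')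
  · rintro ⟨h1, h2⟩
    refine le_iff_inv_mem.2 ⟨?_, ?_⟩
    · rintro _ ⟨r, rfl⟩
      exact (V.valuation_le_one_iff _).1 (h1 r)
    · rintro _ ⟨r, rfl⟩ hinv
      have hinv : V.valuation (algebraMap R F r)⁻¹ ≤ 1 := (V.valuation_le_one_iff _).2 hinv
      by_cases hr : IsUnit r
      · obtain ⟨u, rfl⟩ := hr
        refine ⟨(u⁻¹ : Rˣ), ?_⟩
        rw [eq_comm, inv_eq_of_mul_eq_one_right]
        rw [← map_mul, Units.mul_inv, map_one]
      · have hlt := h2 r hr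
        by_cases h0 : algebraMap R F r = 0
        · simp [h0]
        · rw [map_inv₀, inv_le_one₀ (zero_lt_iff.2 ((Valuation.ne_zero_iff _).2 h0))] at hinv
          exact absurd hlt hinv.not_gt

theorem CenteredValuation.range_le_ring [IsFractionRing R F] (ν : CenteredValuation R F) :
    LocalSubring.range (algebraMap R F) ≤ ν.ring := by
  refine range_le_iff.2 ⟨fun r => ?_, fun r hr => ?_⟩
  · exact (Valuation.isEquiv_valuation_valuationSubring ν.val).le_one_iff_le_one.1 (ν.val_le_one r)
  · exact (Valuation.isEquiv_valuation_valuationSubring ν.val).lt_one_iff_lt_one.1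
      (ν.val_lt_one r hr)

/-- The centered valuation of a valuation ring that dominates `R`. -/
def CenteredValuation.ofValuationSubring [IsFractionRing R F] (V : ValuationSubring F)
    (h : LocalSubring.range (algebraMap R F) ≤ V.toLocalSubring) : CenteredValuation R F where
  Γ₀ := V.ValueGroup
  val := V.valuation
  val_le_one := (range_le_iff.1 h).1
  val_lt_one := (range_le_iff.1 h).2

theorem CenteredValuation.ring_ofValuationSubring [IsFractionRing R F] (V : ValuationSubring F)
    (h : LocalSubring.range (algebraMap R F) ≤ V.toLocalSubring) :
    (CenteredValuation.ofValuationSubring V h).ring = V.toLocalSubring :=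
  congrArg _ V.valuationSubring_valuation

theorem CenteredValuation.equiv_iff_ring_eq {ν μ : CenteredValuation R F} :
    ν ≈ μ ↔ ν.ring = μ.ring :=
  (Valuation.isEquiv_iff_valuationSubring _ _).trans
    ValuationSubring.toLocalSubring_injective.eq_iff.symm

section Sequence

variable {s : Stream'.Seq (LocalSubring F)}

theorem IsSimpleSequence.exists_pred (hs : IsSimpleSequence R s) {i : ℕ} {B : LocalSubring F}
    (hB : s.get? (i + 1) = some B) :
    ∃ A, s.get? i = some A ∧ IsLocalBlowup A B ∧ ¬ (maximalIdeal A.toSubring).IsPrincipal := by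
  cases hA : s.get? i with
  | none => exact absurd (s.2 hA) (by change s.get? (i + 1) ≠ none; simp [hB])
  | some A =>
    have hp : ¬ (maximalIdeal A.toSubring).IsPrincipal := fun hp => by
      simp [(hs.2 i A hA).1 hp] at hB
    obtain ⟨B', hB', hAB⟩ := (hs.2 i A hA).2 hp
    obtain rfl : B = B' := Option.some_injective _ (hB.symm.trans hB')
    exact ⟨A, rfl, hAB, hp⟩

theorem IsSimpleSequence.isRegularOrPrincipal (hs : IsSimpleSequence R s)
    (hR : IsRegularOrPrincipal (LocalSubring.range (algebraMap R F))) {i : ℕ} {A : LocalSubring F}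
    (hA : s.get? i = some A) : IsRegularOrPrincipal A := by
  induction i generalizing A with
  | zero => exact Option.some_injective _ (hs.1.symm.trans hA) ▸ hR
  | succ i ih =>
    obtain ⟨A', hA', hb, hp⟩ := hs.exists_pred hA
    exact hb.isRegularOrPrincipal (ih hA') hp

theorem IsSimpleSequence.le_of_le (hs : IsSimpleSequence R s) {i j : ℕ} (hij : i ≤ j)
    {A B : LocalSubring F} (hA : s.get? i = some A) (hB : s.get? j = some B) : A ≤ B := by
  induction j, hij using Nat.le_induction generalizing B with
  | base => exact (Option.some_injective _ (hA.symm.trans hB)).le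
  | succ j _ ih =>
    obtain ⟨B', hB', hb, -⟩ := hs.exists_pred hB
    exact (ih hB').trans hb.le

theorem IsSimpleSequence.le_or_le (hs : IsSimpleSequence R s) {A B : LocalSubring F}
    (hA : A ∈ s) (hB : B ∈ s) : A ≤ B ∨ B ≤ A := by
  obtain ⟨i, hi⟩ := hA
  obtain ⟨j, hj⟩ := hB
  exact (le_total i j).imp (fun h => hs.le_of_le h hi.symm hj.symm)
    fun h => hs.le_of_le h hj.symm hi.symm

theorem IsSimpleSequence.range_mem (hs : IsSimpleSequence R s) :
    LocalSubring.range (algebraMap R F) ∈ s := Stream'.Seq.get?_mem hs.1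

/-- A member with principal maximal ideal is itself a valuation ring; without one the sequence is
infinite and the preceding part applies. -/
theorem IsSimpleSequence.exists_mem_or_inv_mem [IsFractionRing R F] (hs : IsSimpleSequence R s)
    (hR : IsRegularOrPrincipal (LocalSubring.range (algebraMap R F))) (f : F) :
    ∃ A ∈ s, f ∈ A.toSubring ∨ f⁻¹ ∈ A.toSubring := by
  by_cases hp : ∃ A ∈ s, (maximalIdeal A.toSubring).IsPrincipal
  · obtain ⟨A, hA, hp⟩ := hp
    refine ⟨A, hA, ?_⟩
    obtain ⟨i, hi⟩ := hA
    have := (hs.isRegularOrPrincipal hR hi.symm).1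
    have : IsFractionRing A.toSubring F :=
      isFractionRing_of_le (hs.le_of_le i.zero_le hs.1 hi.symm).1
    have : ValuationRing A.toSubring :=
      ((tfae_of_isNoetherianRing_of_isLocalRing_of_isDomain A.toSubring).out 4 1).1 hp
    refine (ValuationRing.isInteger_or_isInteger A.toSubring f).imp ?_ ?_
    · rintro ⟨a, rfl⟩
      exact a.2
    · rintro ⟨a, ha⟩
      exact ha ▸ a.2
  · push Not at hp
    have hex : ∀ i, ∃ A, s.get? i = some A := fun i => by
      induction i with
      | zero => exact ⟨_, hs.1⟩
      | succ i ih =>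
        obtain ⟨A, hA⟩ := ih
        obtain ⟨B, hB, -⟩ := (hs.2 i A hA).2 (hp A (Stream'.Seq.get?_mem hA))
        exact ⟨B, hB⟩
    choose A hA using hex
    have hA0 : A 0 = LocalSubring.range (algebraMap R F) :=
      Option.some_injective _ ((hA 0).symm.trans hs.1)
    have : IsFractionRing (A 0).toSubring F := by
      rw [hA0]
      infer_instance
    obtain ⟨i, hi⟩ := LocalBlowup.exists_mem_or_inv_mem A (fun i => by
      obtain ⟨A', hA', hb, -⟩ := hs.exists_pred (hA (i + 1))
      rwa [Option.some_injective _ ((hA i).symm.trans hA')])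
      (fun i => hs.isRegularOrPrincipal hR (hA i)) (fun i => hp _ (Stream'.Seq.get?_mem (hA i))) f
    exact ⟨A i, Stream'.Seq.get?_mem (hA i), hi⟩

/-- The union of a simple sequence is a valuation ring that dominates all its members. -/
theorem SimpleSequence.exists_valuationSubring [IsFractionRing R F] (s : SimpleSequence R F)
    (hR : IsRegularOrPrincipal (LocalSubring.range (algebraMap R F))) :
    ∃ V : ValuationSubring F, (V : Set F) = s.union ∧ ∀ A ∈ s.1, A ≤ V.toLocalSubring := by
  obtain ⟨s, hs⟩ := s
  have hne : Nonempty {A // A ∈ s} := ⟨⟨_, hs.range_mem⟩⟩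
  have hdir : Directed (· ≤ ·) fun A : {A // A ∈ s} => A.1.toSubring := fun A B =>
    (hs.le_or_le A.2 B.2).elim (fun h => ⟨B, h.1, le_rfl⟩) fun h => ⟨A, le_rfl, h.1⟩
  have hmem : ∀ z, z ∈ (⨆ A : {A // A ∈ s}, A.1.toSubring) ↔ ∃ A ∈ s, z ∈ A.toSubring := fun z =>
    (Subring.mem_iSup_of_directed hdir).trans (by simp)
  let V : ValuationSubring F :=
    { (⨆ A : {A // A ∈ s}, A.1.toSubring) with
      mem_or_inv_mem' := fun z => by
        obtain ⟨A, hA, h⟩ := hs.exists_mem_or_inv_mem hR z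
        exact h.imp (fun h => (hmem _).2 ⟨A, hA, h⟩) fun h => (hmem _).2 ⟨A, hA, h⟩ }
  have hV : ∀ z, z ∈ V ↔ ∃ A ∈ s, z ∈ A.toSubring := hmem
  refine ⟨V, ?_, fun A hA => le_iff_inv_mem.2
    ⟨fun z hz => (hV z).2 ⟨A, hA, hz⟩, fun z hz hz' => ?_⟩⟩
  · ext z
    simp [SimpleSequence.union, hV]
  · obtain ⟨B, hB, hzB⟩ := (hV _).1 hz'
    obtain h | h := hs.le_or_le hA hB
    · exact (le_iff_inv_mem.1 h).2 z hz hzB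
    · exact h.1 hzB

/-- Domination passes to the union, and a valuation ring is maximal for domination. -/
theorem CenteredValuation.ring_eq_of_forall_le (ν : CenteredValuation R F)
    (s : SimpleSequence R F) (hν : ∀ A ∈ s.1, A ≤ ν.ring) {V : ValuationSubring F}
    (hV : (V : Set F) = s.union) : ν.ring = V.toLocalSubring := by
  have hmem : ∀ z, z ∈ V ↔ ∃ A ∈ s.1, z ∈ A.toSubring := fun z => by
    rw [← SetLike.mem_coe, hV]
    simp [SimpleSequence.union]
  refine (V.isMax_toLocalSubring.eq_of_le <|
    le_iff_inv_mem.2 ⟨fun z hz => ?_, fun z hz hz' => ?_⟩).symm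
  · obtain ⟨A, hA, hzA⟩ := (hmem z).1 hz
    exact (hν A hA).1 hzA
  · obtain ⟨A, hA, hzA⟩ := (hmem z).1 hz
    exact (hmem _).2 ⟨A, hA, (le_iff_inv_mem.1 (hν A hA)).2 z hzA hz'⟩

end Sequence

section Centers

variable (V : ValuationSubring F)

open Classical in
/-- The centre of `V` on the blowing up of `A`, if `𝔪` is not principal. -/
def nextCenter (A : LocalSubring F) : Option (LocalSubring F) :=
  if h : ¬ (maximalIdeal A.toSubring).IsPrincipal ∧
    ∃ B, IsLocalBlowup A B ∧ B ≤ V.toLocalSubring then some h.2.choose else none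

variable (R) in
/-- The sequence of centres of `V`. -/
def centers : Stream'.Seq (LocalSubring F) :=
  ⟨fun n => Nat.rec (some (LocalSubring.range (algebraMap R F)))
      (fun _ o => o.bind (nextCenter V)) n,
    fun {n} h => by
      change Option.bind _ _ = none
      rw [show Nat.rec (some (LocalSubring.range (algebraMap R F)))
        (fun _ o => o.bind (nextCenter V)) n = none from h]
      rfl⟩

theorem centers_get?_succ (i : ℕ) :
    (centers R V).get? (i + 1) = ((centers R V).get? i).bind (nextCenter V) := rfl

variable {V}

/-- Regularity is carried along with domination because together they guarantee the next centre. -/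
theorem le_of_mem_centers (hV : LocalSubring.range (algebraMap R F) ≤ V.toLocalSubring)
    (hR : IsRegularOrPrincipal (LocalSubring.range (algebraMap R F))) (i : ℕ) (A : LocalSubring F)
    (hA : (centers R V).get? i = some A) : A ≤ V.toLocalSubring ∧ IsRegularOrPrincipal A := by
  induction i generalizing A with
  | zero =>
    obtain rfl : LocalSubring.range (algebraMap R F) = A := Option.some_injective _ hA
    exact ⟨hV, hR⟩
  | succ i ih =>
    rw [centers_get?_succ, Option.bind_eq_some_iff] at hA
    obtain ⟨A', hA', h⟩ := hA
    rw [nextCenter] at h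
    split_ifs at h with hc
    obtain rfl := Option.some_injective _ h
    exact ⟨hc.2.choose_spec.2, hc.2.choose_spec.1.isRegularOrPrincipal (ih A' hA').2 hc.1⟩

theorem isSimpleSequence_centers (hV : LocalSubring.range (algebraMap R F) ≤ V.toLocalSubring)
    (hR : IsRegularOrPrincipal (LocalSubring.range (algebraMap R F))) :
    IsSimpleSequence R (centers R V) := by
  refine ⟨rfl, fun i A hA => ⟨fun hp => ?_, fun hp => ?_⟩⟩
  · rw [centers_get?_succ, hA, Option.bind_some, nextCenter, dif_neg fun h => h.1 hp]
  · obtain ⟨hAV, hAr⟩ := le_of_mem_centers hV hR i A hA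
    have hex := exists_isLocalBlowup_le hAr hp hAV
    refine ⟨hex.choose, ?_, hex.choose_spec.1⟩
    rw [centers_get?_succ, hA, Option.bind_some, nextCenter, dif_pos ⟨hp, hex⟩]

end Centers

/-- Two simple sequences dominated by the same local ring coincide. -/
theorem SimpleSequence.eq_of_forall_le {s t : SimpleSequence R F} {C : LocalSubring F}
    (hs : ∀ A ∈ s.1, A ≤ C) (ht : ∀ A ∈ t.1, A ≤ C) : s = t := by
  refine Subtype.ext (Stream'.Seq.ext fun n => ?_)
  induction n with
  | zero => exact s.2.1.trans t.2.1.symm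
  | succ n ih =>
    cases hA : s.1.get? n with
    | none => exact (s.1.2 hA).trans (t.1.2 (ih.symm.trans hA)).symm
    | some A =>
      have hA' : t.1.get? n = some A := ih.symm.trans hA
      by_cases hp : (maximalIdeal A.toSubring).IsPrincipal
      · rw [(s.2.2 n A hA).1 hp, (t.2.2 n A hA').1 hp]
      · obtain ⟨B, hB, hAB⟩ := (s.2.2 n A hA).2 hp
        obtain ⟨B', hB', hAB'⟩ := (t.2.2 n A hA').2 hp
        rw [hB, hB', hAB.eq_of_le hAB' (hs B (Stream'.Seq.get?_mem hB))
          (ht B' (Stream'.Seq.get?_mem hB'))]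

/-- The simple sequence of centres of a valuation. -/
def CenteredValuation.sequence [IsFractionRing R F] (ν : CenteredValuation R F)
    (hR : IsRegularOrPrincipal (LocalSubring.range (algebraMap R F))) : SimpleSequence R F :=
  ⟨centers R ν.val.valuationSubring, isSimpleSequence_centers ν.range_le_ring hR⟩

theorem CenteredValuation.le_ring_of_mem_sequence [IsFractionRing R F] (ν : CenteredValuation R F)
    (hR : IsRegularOrPrincipal (LocalSubring.range (algebraMap R F))) {A : LocalSubring F}
    (hA : A ∈ (ν.sequence hR).1) : A ≤ ν.ring := by
  obtain ⟨i, hi⟩ := hA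
  exact (le_of_mem_centers ν.range_le_ring hR i A hi.symm).1

theorem CenteredValuation.sequence_eq_iff [IsFractionRing R F] (ν : CenteredValuation R F)
    (hR : IsRegularOrPrincipal (LocalSubring.range (algebraMap R F))) {s : SimpleSequence R F} :
    ν.sequence hR = s ↔ ∀ A ∈ s.1, A ≤ ν.ring := by
  constructor
  · rintro rfl A hA
    exact ν.le_ring_of_mem_sequence hR hA
  · exact SimpleSequence.eq_of_forall_le fun A hA => ν.le_ring_of_mem_sequence hR hA

/-- The bijection between centered valuations and simple sequences. -/
def sequenceEquiv [IsFractionRing R F]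
    (hR : IsRegularOrPrincipal (LocalSubring.range (algebraMap R F))) :
    Quotient (CenteredValuation.setoid R F) ≃ SimpleSequence R F :=
  Equiv.ofBijective
    (Quotient.lift (fun ν => ν.sequence hR) fun ν μ h => by
      rw [ν.sequence_eq_iff hR, CenteredValuation.equiv_iff_ring_eq.1 h]
      exact fun A hA => μ.le_ring_of_mem_sequence hR hA) <| by
    constructor
    · rintro ⟨ν⟩ ⟨μ⟩ h
      have h : ν.sequence hR = μ.sequence hR := h
      refine Quotient.sound (CenteredValuation.equiv_iff_ring_eq.2 ?_)
      -- Both valuation rings equal the union of the common sequence.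
      obtain ⟨V, hV, -⟩ := (μ.sequence hR).exists_valuationSubring hR
      rw [ν.ring_eq_of_forall_le _ ((ν.sequence_eq_iff hR).1 h) hV,
        μ.ring_eq_of_forall_le _ ((μ.sequence_eq_iff hR).1 rfl) hV]
    · intro s
      obtain ⟨V, -, hV⟩ := s.exists_valuationSubring hR
      have hRV := hV _ s.2.range_mem
      refine ⟨⟦CenteredValuation.ofValuationSubring V hRV⟧, ?_⟩
      refine (CenteredValuation.sequence_eq_iff _ hR).2 fun A hA => ?_
      rw [CenteredValuation.ring_ofValuationSubring]
      exact hV A hA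

end Correspondence

end LocalBlowup

end

theorem mainTheorem3 {R : Type v} {F : Type u} [CommRing R] [IsRegularLocalRing R]
    (hdim : ringKrullDim R = 2) [Field F] [Algebra R F] [IsFractionRing R F] :
    ∃ Φ : Quotient (LocalBlowup.CenteredValuation.setoid R F) ≃ LocalBlowup.SimpleSequence R F,
      (∀ (ν : LocalBlowup.CenteredValuation R F) (s : LocalBlowup.SimpleSequence R F),
        Φ ⟦ν⟧ = s ↔ ∀ A ∈ s.1, A ≤ ν.ring) ∧
      (∀ (ν : LocalBlowup.CenteredValuation R F) (i : ℕ) (A B : LocalSubring F),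
        (Φ ⟦ν⟧).1.get? i = some A → (Φ ⟦ν⟧).1.get? (i + 1) = some B →
          ∀ B' : LocalSubring F, LocalBlowup.IsLocalBlowup A B' → (B' ≤ ν.ring ↔ B' = B)) ∧
      (∀ ν : LocalBlowup.CenteredValuation R F,
        (ν.ring.toSubring : Set F) = (Φ ⟦ν⟧).union) := by
  have : IsDomain R := (IsFractionRing.injective R F).isDomain (algebraMap R F)
  have hR : LocalBlowup.IsRegularOrPrincipal (LocalSubring.range (algebraMap R F)) := by
    obtain ⟨x, y, hxy⟩ := LocalBlowup.exists_isRegularPair hdim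
    exact ⟨isNoetherianRing_of_ringEquiv R (LocalBlowup.rangeEquiv R F),
      .inr ⟨_, _, hxy.map_ringEquiv (LocalBlowup.rangeEquiv R F)⟩⟩
  refine ⟨LocalBlowup.sequenceEquiv hR, fun ν s => ν.sequence_eq_iff hR, ?_, fun ν => ?_⟩
  · intro ν i A B hA hB B' hB'
    obtain ⟨A', hA', hAB, -⟩ := (LocalBlowup.sequenceEquiv hR ⟦ν⟧).2.exists_pred hB
    obtain rfl : A = A' := Option.some_injective _ (hA.symm.trans hA')
    have hBν : B ≤ ν.ring := ν.le_ring_of_mem_sequence hR (Stream'.Seq.get?_mem hB)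
    exact ⟨fun h => hB'.eq_of_le hAB h hBν, fun h => h ▸ hBν⟩
  · obtain ⟨V, hV, -⟩ := (LocalBlowup.sequenceEquiv hR ⟦ν⟧).exists_valuationSubring hR
    rw [ν.ring_eq_of_forall_le _ (fun A hA => ν.le_ring_of_mem_sequence hR hA) hV, ← hV]
    rfl
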